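/- Let $k$ be an algebraically closed field, $N=\mathbb{Z}^n$ a lattice with dual lattice $M$, and $T=\operatorname{Spec} k[M]$ the corresponding torus, with characters $\chi(m)$, $m\in M$. Let $\Delta$ be a fan in $N_{\mathbb R}$, i.e. a finite nonempty set of strongly convex rational polyhedral cones, closed under taking faces, such that any two of its cones intersect in a common face. For $\sigma\in\Delta$ put $\sigma_M=\{m\in M : m|_\sigma\ge 0\}$, $\sigma_M^\perp=\{m\in M : m|_\sigma=0\}$ and $U_\sigma=\operatorname{Spec} k[\sigma_M]$, and let $X_\Delta$ be the toric variety obtained by gluing the $U_\sigma$ along common faces, with its $T$-action $a\colon T\times X_\Delta\to X_\Delta$ (given on functions by $\chi(m)\mapsto\chi(m)\otimes\chi(m)$) and the projection $p\colon T\times X_\Delta\to X_\Delta$. An equivariant quasicoherent sheaf on $X_\Delta$ is a quasicoherent sheaf $\mathcal E$ with a linearization, that is, an isomorphism $\Phi\colon a^*\mathcal E\to p^*\mathcal E$ on $T\times X_\Delta$ satisfying the cocycle condition $(\mu\times \mathrm{id})^*\Phi=p_{23}^*\Phi\circ(\mathrm{id}\times a)^*\Phi$ on $T\times T\times X_\Delta$,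 where $\mu$ is the multiplication of $T$. Its associated $\Delta$-family consists, for each $\sigma\in\Delta$, of the $\sigma$-family given by the isotypical components $$E^\sigma_m=\{s\in\Gamma(U_\sigma,\mathcal E) : \Phi(a^*s)=\chi(m)\,p^*s\},\qquad m\in M,$$ and the maps $\chi^\sigma_{m,m'}\colon E^\sigma_m\to E^\sigma_{m'}$ given by multiplication with $\chi(m'-m)$ whenever $m\le_\sigma m'$. Here $m\le_\sigma m'$ means $m'-m\in\sigma_M$, and $m<_\sigma m'$ means $m\le_\sigma m'$ and not $m'\le_\sigma m$. The $\sigma$-family is called finite if 1. all the vector spaces $E^\sigma_m$ are finite-dimensional; 2. for each chain $\cdots<_\sigma m_{i-1}<_\sigma m_i<_\sigma\cdots$ ($i\in\mathbb Z$) in $M$ there is an $i_0\in\mathbb Z$ such that $E^\sigma_{m_i}=0$ for all $i<i_0$; 3. up to translation by $\sigma_M^\perp$ there are only finitely many $m\in M$ for which the map $\bigoplus_{m'<_\sigma m}E^\sigma_{m'}\to E^\sigma_m$, defined by summation of the $\chi^\sigma_{m',m}$, is not surjective; i.e. the set of the classes in $M/\sigma_M^\perp$ of all such $m$ is finite. A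 $\Delta$-family is called finite if all of its $\sigma$-families, $\sigma\in\Delta$, are finite. **Proposition.** An equivariant quasicoherent sheaf on $X_\Delta$ is coherent if and only if its associated $\Delta$-family is finite. -/

import Mathlib

universe u

open CategoryTheory Limits AlgebraicGeometry

noncomputable section

namespace Toric

/-- The pairing between the character lattice `M = ℤⁿ` and `N_ℝ = ℝⁿ`, where `N = ℤⁿ`. -/
def pairing {n : ℕ} (m : Fin n → ℤ) (v : Fin n → ℝ) : ℝ := ∑ i, (m i : ℝ) * v i

section Cones

variable {n : ℕ}

lemma pairing_add_left (m m' : Fin n → ℤ) (v : Fin n → ℝ) :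
    pairing (m + m') v = pairing m v + pairing m' v := by
  simp [pairing, add_mul, Finset.sum_add_distrib]

lemma pairing_zero_left (v : Fin n → ℝ) : pairing (0 : Fin n → ℤ) v = 0 := by
  simp [pairing]

lemma pairing_neg_left (m : Fin n → ℤ) (v : Fin n → ℝ) : pairing (-m) v = -pairing m v := by
  simp [pairing]

lemma pairing_nsmul_left (N : ℕ) (m : Fin n → ℤ) (v : Fin n → ℝ) :
    pairing (N • m) v = N * pairing m v := by
  simp [pairing, Finset.mul_sum, mul_assoc]

/-- The real cone `σ ⊆ N_ℝ` is spanned by finitely many elements of the lattice `N`. -/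
def IsRationalPolyhedral (σ : PointedCone ℝ (Fin n → ℝ)) : Prop :=
  ∃ S : Finset (Fin n → ℤ),
    σ = PointedCone.hull ℝ ((fun (v : Fin n → ℤ) (i : Fin n) => (v i : ℝ)) '' (S : Set (Fin n → ℤ)))

/-- The semigroup `σ_M = σ^∨ ∩ M`. -/
def dualMonoid (σ : PointedCone ℝ (Fin n → ℝ)) : AddSubmonoid (Fin n → ℤ) where
  carrier := {m | ∀ v ∈ σ, 0 ≤ pairing m v}
  zero_mem' v _ := (pairing_zero_left v).ge
  add_mem' ha hb v hv := by rw [pairing_add_left]; exact add_nonneg (ha v hv) (hb v hv)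

/-- The group `σ_M^⊥ = σ^⊥ ∩ M`. -/
def perp (σ : PointedCone ℝ (Fin n → ℝ)) : AddSubgroup (Fin n → ℤ) where
  carrier := {m | ∀ v ∈ σ, pairing m v = 0}
  zero_mem' v _ := pairing_zero_left v
  add_mem' ha hb v hv := by rw [pairing_add_left, ha v hv, hb v hv, add_zero]
  neg_mem' ha v hv := by rw [pairing_neg_left, ha v hv, neg_zero]

/-- `τ` is a face of `σ`: it is cut out from `σ` by a hyperplane `m^⊥` with `m ∈ σ^∨ ∩ M`. -/
def IsFace (τ σ : PointedCone ℝ (Fin n → ℝ)) : Prop :=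
  ∃ m ∈ dualMonoid σ, ∀ v, v ∈ τ ↔ v ∈ σ ∧ pairing m v = 0

lemma dualMonoid_anti {τ σ : PointedCone ℝ (Fin n → ℝ)} (h : τ ≤ σ) :
    dualMonoid σ ≤ dualMonoid τ := fun _ hm v hv => hm v (h hv)

lemma IsFace.le {τ σ : PointedCone ℝ (Fin n → ℝ)} (h : IsFace τ σ) : τ ≤ σ := by
  obtain ⟨m, -, h⟩ := h
  exact fun v hv => ((h v).1 hv).1

lemma IsFace.inf {τ τ' σ : PointedCone ℝ (Fin n → ℝ)} (h : IsFace τ σ) (h' : IsFace τ' σ) :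
    IsFace (τ ⊓ τ') σ := by
  obtain ⟨m, hm, h⟩ := h
  obtain ⟨m', hm', h'⟩ := h'
  refine ⟨m + m', add_mem hm hm', fun v => ?_⟩
  rw [Submodule.mem_inf, h, h', pairing_add_left]
  constructor
  · rintro ⟨⟨hv, h1⟩, -, h2⟩
    exact ⟨hv, by rw [h1, h2, add_zero]⟩
  · rintro ⟨hv, h0⟩
    have h1 := hm v hv
    have h2 := hm' v hv
    exact ⟨⟨hv, by linarith⟩, hv, by linarith⟩

lemma mem_dualMonoid_hull {S : Finset (Fin n → ℤ)} {m : Fin n → ℤ}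
    (h : ∀ v ∈ S, 0 ≤ pairing m (fun i => (v i : ℝ))) :
    m ∈ dualMonoid (PointedCone.hull ℝ
      ((fun (v : Fin n → ℤ) (i : Fin n) => (v i : ℝ)) '' (S : Set (Fin n → ℤ)))) := by
  intro v hv
  induction hv using Submodule.span_induction with
  | mem x hx => obtain ⟨w, hw, rfl⟩ := hx; exact h w hw
  | zero => simp [pairing]
  | add x y _ _ hx hy =>
    have : pairing m (x + y) = pairing m x + pairing m y := by
      simp [pairing, mul_add, Finset.sum_add_distrib]
    rw [this]; exact add_nonneg hx hy
  | smul a x _ hx =>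
    have : pairing m (a • x) = (a : ℝ) * pairing m x := by
      simp only [pairing, Finset.mul_sum]
      refine Finset.sum_congr rfl fun i _ => ?_
      change (m i : ℝ) * ((a : ℝ) * x i) = _
      ring
    rw [this]; exact mul_nonneg a.2 hx

/-- If `τ = σ ∩ m^⊥` with `m ∈ σ_M`, then `τ_M = σ_M + ℕ (-m)`. -/
lemma exists_nsmul_add_mem {τ σ : PointedCone ℝ (Fin n → ℝ)} (hσ : IsRationalPolyhedral σ)
    {m : Fin n → ℤ} (hm : m ∈ dualMonoid σ) (h : ∀ v, v ∈ τ ↔ v ∈ σ ∧ pairing m v = 0)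
    {w : Fin n → ℤ} (hw : w ∈ dualMonoid τ) : ∃ N₀ : ℕ, ∀ N ≥ N₀, w + N • m ∈ dualMonoid σ := by
  obtain ⟨S, rfl⟩ := hσ
  obtain ⟨N₀, hN₀⟩ : ∃ N₀ : ℕ, ∀ v ∈ S, -pairing w (fun i => (v i : ℝ)) ≤ N₀ := by
    obtain ⟨b, hb⟩ := (S.image fun v => -pairing w (fun i => (v i : ℝ))).bddAbove
    obtain ⟨N₀, h⟩ := exists_nat_ge b
    exact ⟨N₀, fun v hv => (hb (Finset.mem_image_of_mem _ hv)).trans h⟩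
  refine ⟨N₀, fun N hN => mem_dualMonoid_hull fun v hv => ?_⟩
  have hvσ : (fun i => (v i : ℝ)) ∈ PointedCone.hull ℝ
      ((fun (v : Fin n → ℤ) (i : Fin n) => (v i : ℝ)) '' (S : Set (Fin n → ℤ))) :=
    Submodule.subset_span ⟨v, hv, rfl⟩
  rw [pairing_add_left, pairing_nsmul_left]
  have hint : pairing m (fun i => (v i : ℝ)) = ((∑ i, m i * v i : ℤ) : ℝ) := by simp [pairing]
  have h0 := hm _ hvσ
  rcases h0.eq_or_lt with h0 | h0
  · have := hw _ ((h _).2 ⟨hvσ, h0.symm⟩)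
    rw [← h0]; simpa using this
  · have h1 : 1 ≤ pairing m (fun i => (v i : ℝ)) := by
      rw [hint] at h0 ⊢
      exact_mod_cast (Int.add_one_le_iff.2 (by exact_mod_cast h0) :
        (0 : ℤ) + 1 ≤ ∑ i, m i * v i)
    have h2 := hN₀ v hv
    have h3 : (N₀ : ℝ) ≤ N := by exact_mod_cast hN
    nlinarith

end Cones

/-- A fan in `N_ℝ = ℝⁿ`: a finite nonempty set of strongly convex rational polyhedral cones,
closed under faces, such that any two of its cones intersect in a common face. -/
structure Fan (n : ℕ) where
  cones : Set (PointedCone ℝ (Fin n → ℝ))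
  finite : cones.Finite
  nonempty : cones.Nonempty
  rational : ∀ σ ∈ cones, IsRationalPolyhedral σ
  strongly_convex : ∀ σ ∈ cones, ∀ v, v ∈ σ → -v ∈ σ → v = 0
  face_mem : ∀ σ ∈ cones, ∀ τ, IsFace τ σ → τ ∈ cones
  inter_face : ∀ σ ∈ cones, ∀ τ ∈ cones, IsFace (σ ⊓ τ) σ

section Affine

variable (k : Type u) [Field k] {n : ℕ}

/-- The coordinate ring `k[σ_M]` of the affine toric variety `U_σ`. -/
abbrev CoordRing (σ : PointedCone ℝ (Fin n → ℝ)) : Type u := AddMonoidAlgebra k (dualMonoid σ)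

/-- For `τ ⊆ σ` the inclusion `k[σ_M] → k[τ_M]`. -/
def coordRingMap {τ σ : PointedCone ℝ (Fin n → ℝ)} (h : τ ≤ σ) :
    CoordRing k σ →+* CoordRing k τ :=
  AddMonoidAlgebra.mapDomainRingHom k (AddSubmonoid.inclusion (dualMonoid_anti h))

lemma coordRingMap_single {τ σ : PointedCone ℝ (Fin n → ℝ)} (h : τ ≤ σ) (m : dualMonoid σ)
    (c : k) : coordRingMap k h (AddMonoidAlgebra.single m c) =
      AddMonoidAlgebra.single (AddSubmonoid.inclusion (dualMonoid_anti h) m) c := by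
  simp [coordRingMap]

/-- `k[τ_M]` is the localization of `k[σ_M]` at `χ(m)` if `τ = σ ∩ m^⊥`. -/
lemma isLocalization_coordRingMap {τ σ : PointedCone ℝ (Fin n → ℝ)}
    (hσ : IsRationalPolyhedral σ) (hle : τ ≤ σ) {m : Fin n → ℤ} (hm : m ∈ dualMonoid σ)
    (h : ∀ v, v ∈ τ ↔ v ∈ σ ∧ pairing m v = 0) :
    letI := (coordRingMap k hle).toAlgebra
    IsLocalization.Away (AddMonoidAlgebra.single (⟨m, hm⟩ : dualMonoid σ) (1 : k))
      (CoordRing k τ) := by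
  let _ := (coordRingMap k hle).toAlgebra
  have hinj : Function.Injective (coordRingMap k hle) :=
    AddMonoidAlgebra.mapDomain_injective (AddSubmonoid.inclusion_injective (dualMonoid_anti hle))
  have hneg : -m ∈ dualMonoid τ := fun v hv => by
    rw [pairing_neg_left, ((h v).1 hv).2, neg_zero]
  have hpos : m ∈ dualMonoid τ := dualMonoid_anti hle hm
  refine IsLocalization.Away.mk _ ?_ ?_ ?_
  · refine IsUnit.of_mul_eq_one (AddMonoidAlgebra.single (⟨-m, hneg⟩ : dualMonoid τ) (1 : k)) ?_
    change coordRingMap k hle _ * _ = _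
    rw [coordRingMap_single, AddMonoidAlgebra.single_mul_single, AddMonoidAlgebra.one_def]
    congr 1
    · ext1; simp
    · simp
  · intro f
    change ∃ N a, f * (coordRingMap k hle _) ^ N = coordRingMap k hle a
    induction f using AddMonoidAlgebra.induction_linear with
    | zero => exact ⟨0, 0, by simp⟩
    | add f g hf hg =>
      obtain ⟨N, a, ha⟩ := hf
      obtain ⟨N', b, hb⟩ := hg
      refine ⟨N + N', a * AddMonoidAlgebra.single (⟨m, hm⟩ : dualMonoid σ) (1 : k) ^ N' +
        b * AddMonoidAlgebra.single (⟨m, hm⟩ : dualMonoid σ) (1 : k) ^ N, ?_⟩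
      rw [map_add, map_mul, map_mul, map_pow, map_pow, ← ha, ← hb]
      ring
    | single w c =>
      obtain ⟨N₀, hN⟩ := exists_nsmul_add_mem hσ hm h w.2
      refine ⟨N₀, AddMonoidAlgebra.single ⟨_, hN N₀ le_rfl⟩ c, ?_⟩
      rw [coordRingMap_single, coordRingMap_single, AddMonoidAlgebra.single_pow,
        AddMonoidAlgebra.single_mul_single, one_pow, mul_one]
      rfl
  · intro a b hab
    exact ⟨0, by rw [hinj hab]⟩

end Affine

section Scheme

variable (k : Type u) [Field k] {n : ℕ} (Δ : Fan n)

/-- For `τ ⊆ σ` in `Δ`, the morphism `U_τ → U_σ`. -/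
def affineMap {τ σ : PointedCone ℝ (Fin n → ℝ)} (h : τ ≤ σ) :
    Spec (.of (CoordRing k τ)) ⟶ Spec (.of (CoordRing k σ)) :=
  Spec.map (CommRingCat.ofHom (coordRingMap k h))

/-- The diagram `σ ↦ U_σ = Spec k[σ_M]` over the cones of the fan `Δ`, ordered by inclusion
(for cones of a fan, `τ ⊆ σ` means that `τ` is a face of `σ`). -/
def diagram : Δ.cones ⥤ Scheme.{u} where
  obj σ := Spec (.of (CoordRing k σ.1))
  map f := affineMap k (leOfHom f)
  map_id σ := by
    have : coordRingMap k (le_refl σ.1) = RingHom.id _ := by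
      ext
      · simp [coordRingMap]
      · simp [coordRingMap]; rfl
    change Spec.map (CommRingCat.ofHom (coordRingMap k (le_refl σ.1))) = _
    rw [this]
    exact Spec.map_id _
  map_comp {σ τ ρ} f g := by
    have : coordRingMap k ((leOfHom f).trans (leOfHom g)) =
        (coordRingMap k (leOfHom f)).comp (coordRingMap k (leOfHom g)) := by
      ext
      · simp [coordRingMap]
      · simp [coordRingMap]; rfl
    change Spec.map (CommRingCat.ofHom (coordRingMap k ((leOfHom f).trans (leOfHom g)))) = _
    rw [this, CommRingCat.ofHom_comp, Spec.map_comp]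
    rfl

lemma isFace_of_le {τ σ : Δ.cones} (h : τ ≤ σ) : IsFace τ.1 σ.1 := by
  have := Δ.inter_face _ σ.2 _ τ.2
  rwa [inf_eq_right.2 h] at this

instance isOpenImmersion_diagram_map {τ σ : Δ.cones} (f : τ ⟶ σ) :
    IsOpenImmersion ((diagram k Δ).map f) := by
  obtain ⟨m, hm, h⟩ := isFace_of_le Δ (leOfHom f)
  let _ := (coordRingMap k (leOfHom f)).toAlgebra
  have := isLocalization_coordRingMap k (Δ.rational _ σ.2) (leOfHom f) hm h
  exact IsOpenImmersion.of_isLocalization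
    (AddMonoidAlgebra.single (⟨m, hm⟩ : dualMonoid σ.1) (1 : k))

lemma range_diagram_map {τ σ : Δ.cones} (f : τ ⟶ σ) {m : Fin n → ℤ} (hm : m ∈ dualMonoid σ.1)
    (h : ∀ v, v ∈ τ.1 ↔ v ∈ σ.1 ∧ pairing m v = 0) :
    Set.range ((diagram k Δ).map f) = (PrimeSpectrum.basicOpen
      (AddMonoidAlgebra.single (⟨m, hm⟩ : dualMonoid σ.1) (1 : k)) :
        Set (PrimeSpectrum (CoordRing k σ.1))) := by
  let _ := (coordRingMap k (leOfHom f)).toAlgebra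
  have := isLocalization_coordRingMap k (Δ.rational _ σ.2) (leOfHom f) hm h
  exact PrimeSpectrum.localization_away_comap_range (CoordRing k τ.1)
    (AddMonoidAlgebra.single (⟨m, hm⟩ : dualMonoid σ.1) (1 : k))

instance isLocallyDirected_diagram : (diagram k Δ ⋙ Scheme.forget).IsLocallyDirected where
  cond {τ τ' σ} f f' x x' hx := by
    have hx : (diagram k Δ).map f x = (diagram k Δ).map f' x' := hx
    obtain ⟨m, hm, h⟩ := isFace_of_le Δ (leOfHom f)
    obtain ⟨m', hm', h'⟩ := isFace_of_le Δ (leOfHom f')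
    let ρ : Δ.cones := ⟨τ.1 ⊓ τ'.1, Δ.face_mem _ τ.2 _ (Δ.inter_face _ τ.2 _ τ'.2)⟩
    let g : ρ ⟶ τ := homOfLE (show τ.1 ⊓ τ'.1 ≤ τ.1 from inf_le_left)
    let g' : ρ ⟶ τ' := homOfLE (show τ.1 ⊓ τ'.1 ≤ τ'.1 from inf_le_right)
    have hρ : ∀ v, v ∈ ρ.1 ↔ v ∈ σ.1 ∧ pairing (m + m') v = 0 := fun v => by
      rw [Submodule.mem_inf, h, h', pairing_add_left]
      constructor
      · rintro ⟨⟨hv, h1⟩, -, h2⟩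
        exact ⟨hv, by rw [h1, h2, add_zero]⟩
      · rintro ⟨hv, h0⟩
        have h1 := hm v hv
        have h2 := hm' v hv
        exact ⟨⟨hv, by linarith⟩, hv, by linarith⟩
    have hy : (diagram k Δ).map f x ∈ Set.range ((diagram k Δ).map (g ≫ f)) := by
      rw [range_diagram_map k Δ (g ≫ f) (add_mem hm hm') hρ]
      have e : (AddMonoidAlgebra.single (⟨m + m', add_mem hm hm'⟩ : dualMonoid σ.1) (1 : k)) =
          AddMonoidAlgebra.single (⟨m, hm⟩ : dualMonoid σ.1) (1 : k) *
          AddMonoidAlgebra.single (⟨m', hm'⟩ : dualMonoid σ.1) (1 : k) := by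
        rw [AddMonoidAlgebra.single_mul_single, one_mul]
        rfl
      rw [e, PrimeSpectrum.basicOpen_mul]
      refine ⟨?_, ?_⟩
      · rw [← range_diagram_map k Δ f hm h]; exact ⟨x, rfl⟩
      · rw [← range_diagram_map k Δ f' hm' h', hx]; exact ⟨x', rfl⟩
    obtain ⟨y, hy⟩ := hy
    have h1 : (diagram k Δ).map g y = x := by
      apply ((diagram k Δ).map f).isOpenEmbedding.injective
      rw [← hy, Functor.map_comp]
      rfl
    have h2 : (diagram k Δ).map g' y = x' := by
      apply ((diagram k Δ).map f').isOpenEmbedding.injective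
      rw [← hx, ← hy, show g ≫ f = g' ≫ f' from Subsingleton.elim _ _, Functor.map_comp]
      rfl
    exact ⟨ρ, g, g', y, h1, h2⟩

/-- The toric variety `X_Δ`, glued from the affine toric varieties `U_σ` along common faces. -/
def toricScheme : Scheme.{u} := colimit (diagram k Δ)

/-- The inclusion `U_σ → X_Δ`. -/
def chart (σ : Δ.cones) : Spec (.of (CoordRing k σ.1)) ⟶ toricScheme k Δ :=
  colimit.ι (diagram k Δ) σ

instance (σ : Δ.cones) : IsOpenImmersion (chart k Δ σ) :=
  inferInstanceAs (IsOpenImmersion (colimit.ι (diagram k Δ) σ))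

lemma affineMap_chart {τ σ : Δ.cones} (h : τ ≤ σ) : affineMap k h ≫ chart k Δ σ = chart k Δ τ :=
  colimit.w (diagram k Δ) (homOfLE h)

end Scheme
end Toric

namespace Toric

section Torus

open MonoidalCategory CartesianMonoidalCategory

variable (k : Type u) [Field k] (n : ℕ)

/-- The torus `T = Spec k[M]`, a group scheme over `Spec k`. -/
abbrev torus : Over (Spec (.of k)) :=
  (Spec (.of (AddMonoidAlgebra k (Fin n → ℤ)))).asOver (Spec (.of k))

variable {n} (Δ : Fan n)

/-- The affine toric variety `U_σ` over `Spec k`. -/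
abbrev affineOver (σ : PointedCone ℝ (Fin n → ℝ)) : Over (Spec (.of k)) :=
  (Spec (.of (CoordRing k σ))).asOver (Spec (.of k))

/-- The structure morphism `X_Δ → Spec k`. -/
def toricHom : toricScheme k Δ ⟶ Spec (.of k) :=
  colimit.desc (diagram k Δ)
    { pt := Spec (.of k)
      ι :=
      { app := fun σ => (affineOver k σ.1).hom
        naturality := fun σ τ f => by
          change Spec.map _ ≫ Spec.map _ = Spec.map _ ≫ 𝟙 _
          rw [Category.comp_id, ← Spec.map_comp, ← CommRingCat.ofHom_comp]
          congr 2
          ext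
          simp [coordRingMap] } }

/-- The toric variety `X_Δ` over `Spec k`. -/
abbrev toricOver : Over (Spec (.of k)) := Over.mk (toricHom k Δ)

lemma chart_toricHom (σ : Δ.cones) : chart k Δ σ ≫ toricHom k Δ = (affineOver k σ.1).hom :=
  colimit.ι_desc _ σ

/-- The inclusion `U_σ → X_Δ` over `Spec k`. -/
def chartOver (σ : Δ.cones) : affineOver k σ.1 ⟶ toricOver k Δ :=
  Over.homMk (chart k Δ σ) (chart_toricHom k Δ σ)

/-- The cover of `X_Δ` by the `U_σ`. -/
def toricCover : (toricScheme k Δ).OpenCover := Scheme.IsLocallyDirected.openCover (diagram k Δ)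

instance : Category (toricCover k Δ).I₀ := inferInstanceAs (Category Δ.cones)

instance : (toricCover k Δ).LocallyDirected where
  trans {σ τ} f := (diagram k Δ).map f
  trans_id σ := (diagram k Δ).map_id σ
  trans_comp f g := (diagram k Δ).map_comp f g
  w {σ τ} f := colimit.w (diagram k Δ) f
  directed {σ τ} x := by
    obtain ⟨ρ, f, g, y, h1, h2⟩ := (Scheme.IsLocallyDirected.ι_eq_ι_iff (diagram k Δ)
      (xi := pullback.fst ((toricCover k Δ).f σ) ((toricCover k Δ).f τ) x)
      (xj := pullback.snd ((toricCover k Δ).f σ) ((toricCover k Δ).f τ) x)).1 (by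
        change (toricCover k Δ).f σ _ = (toricCover k Δ).f τ _
        rw [← Scheme.Hom.comp_apply, ← Scheme.Hom.comp_apply, pullback.condition])
    refine ⟨ρ, f, g, y, ?_⟩
    apply (pullback.fst ((toricCover k Δ).f σ) ((toricCover k Δ).f τ)).isOpenEmbedding.injective
    refine Eq.trans ?_ h1
    refine (Scheme.Hom.comp_apply _ _ _).symm.trans ?_
    exact congrArg (fun q : (diagram k Δ).obj ρ ⟶ (diagram k Δ).obj σ => q y)
      (pullback.lift_fst _ _ _)
  property_trans f := isOpenImmersion_diagram_map k Δ f

end Torus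

section Points

/-- The pullback of functions along a morphism to an affine scheme. -/
def pull {Z : Scheme.{u}} {A : Type u} [CommRing A] (f : Z ⟶ Spec (.of A)) : A →+* Γ(Z, ⊤) :=
  ((Scheme.ΓSpecIso (.of A)).inv ≫ f.appTop).hom

/-- The morphism to an affine scheme given by a ring homomorphism to global functions. -/
def ofPull {Z : Scheme.{u}} {A : Type u} [CommRing A] (φ : A →+* Γ(Z, ⊤)) : Z ⟶ Spec (.of A) :=
  Z.toSpecΓ ≫ Spec.map (CommRingCat.ofHom φ)

lemma pull_ofPull {Z : Scheme.{u}} {A : Type u} [CommRing A] (φ : A →+* Γ(Z, ⊤)) :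
    pull (ofPull φ) = φ := by
  have : (Scheme.ΓSpecIso (.of A)).inv ≫ (ofPull φ).appTop = CommRingCat.ofHom φ := by
    simp [ofPull, Scheme.toSpecΓ_appTop]
  rw [pull, this]
  rfl

lemma pull_injective {Z : Scheme.{u}} {A : Type u} [CommRing A] {f g : Z ⟶ Spec (.of A)}
    (h : pull f = pull g) : f = g := by
  refine ext_to_Spec ?_
  ext1
  exact h

lemma pull_comp {W Z : Scheme.{u}} {A : Type u} [CommRing A] (g : W ⟶ Z) (f : Z ⟶ Spec (.of A)) :
    pull (g ≫ f) = g.appTop.hom.comp (pull f) := by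
  rw [pull, Scheme.Hom.comp_appTop]
  rfl

lemma pull_comp_SpecMap {Z : Scheme.{u}} {A B : Type u} [CommRing A] [CommRing B]
    (f : Z ⟶ Spec (.of B)) (φ : A →+* B) :
    pull (f ≫ Spec.map (CommRingCat.ofHom φ)) = (pull f).comp φ := by
  have : (Scheme.ΓSpecIso (.of A)).inv ≫ (f ≫ Spec.map (CommRingCat.ofHom φ)).appTop =
      CommRingCat.ofHom φ ≫ (Scheme.ΓSpecIso (.of B)).inv ≫ f.appTop := by
    simp
  rw [pull, this]
  rfl

end Points
end Toric

namespace Toric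

section Action

open MonoidalCategory CartesianMonoidalCategory

variable (k : Type u) [Field k] {n : ℕ}

/-- On functions, the product `t · u` of an `R`-point `t` of `T` and an `R`-point `u` of `U_σ` is
given by `χ(m) ↦ χ(m)(t) * χ(m)(u)` for `m ∈ σ_M`. -/
def actRingHom {σ : PointedCone ℝ (Fin n → ℝ)} {R : Type u} [CommRing R]
    (φ : AddMonoidAlgebra k (Fin n → ℤ) →+* R) (ψ : CoordRing k σ →+* R) : CoordRing k σ →+* R :=
  AddMonoidAlgebra.liftNCRingHom (ψ.comp (algebraMap k (CoordRing k σ)))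
    { toFun := fun m => φ (AddMonoidAlgebra.single (m.toAdd : Fin n → ℤ) 1) *
        ψ (AddMonoidAlgebra.single m.toAdd 1)
      map_one' := by
        rw [toAdd_one, AddSubmonoid.coe_zero, ← AddMonoidAlgebra.one_def,
          ← AddMonoidAlgebra.one_def, map_one, map_one, one_mul]
      map_mul' := fun m m' => by
        rw [toAdd_mul, AddSubmonoid.coe_add, ← one_mul (1 : k),
          ← AddMonoidAlgebra.single_mul_single, ← AddMonoidAlgebra.single_mul_single,
          map_mul, map_mul, one_mul]
        ring }
    (fun _ _ => Commute.all _ _)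

variable {k}

lemma actRingHom_single {σ : PointedCone ℝ (Fin n → ℝ)} {R : Type u} [CommRing R]
    (φ : AddMonoidAlgebra k (Fin n → ℤ) →+* R) (ψ : CoordRing k σ →+* R) (m : dualMonoid σ)
    (c : k) : actRingHom k φ ψ (AddMonoidAlgebra.single m c) =
      φ (AddMonoidAlgebra.single (m : Fin n → ℤ) 1) * ψ (AddMonoidAlgebra.single m c) := by
  rw [actRingHom, AddMonoidAlgebra.liftNCRingHom_single]
  have : (AddMonoidAlgebra.single m c : CoordRing k σ) =
      algebraMap k (CoordRing k σ) c * AddMonoidAlgebra.single m 1 := by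
    simp
  rw [this, map_mul]
  simp only [RingHom.comp_apply, MonoidHom.coe_mk, OneHom.coe_mk, toAdd_ofAdd]
  ring

lemma coordRing_ringHom_ext {σ : PointedCone ℝ (Fin n → ℝ)} {R : Type u} [CommRing R]
    {φ ψ : CoordRing k σ →+* R}
    (h : ∀ m c, φ (AddMonoidAlgebra.single m c) = ψ (AddMonoidAlgebra.single m c)) : φ = ψ :=
  AddMonoidAlgebra.ringHom_ext' (by ext c; exact h 0 c) (by ext m; exact h _ 1)

/-- The action of `T` on `U_σ` on points: `(t · u)^*(χ(m)) = t^*(χ(m)) * u^*(χ(m))`. -/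
def actPt {σ : PointedCone ℝ (Fin n → ℝ)} {Z : Over (Spec (.of k))}
    (t : Z ⟶ torus k n) (u : Z ⟶ affineOver k σ) : Z ⟶ affineOver k σ :=
  Over.homMk (ofPull (actRingHom k (pull t.left) (pull u.left))) (by
    refine Eq.trans ?_ (Over.w u)
    refine pull_injective ?_
    refine (pull_comp_SpecMap _ (algebraMap k (CoordRing k σ))).trans
      (Eq.trans ?_ (pull_comp_SpecMap _ (algebraMap k (CoordRing k σ))).symm)
    rw [pull_ofPull]
    ext c
    change actRingHom k _ _ (AddMonoidAlgebra.single 0 c) =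
      pull u.left (AddMonoidAlgebra.single 0 c)
    rw [actRingHom_single, AddSubmonoid.coe_zero, ← AddMonoidAlgebra.one_def, map_one, one_mul])

variable {σ τ : PointedCone ℝ (Fin n → ℝ)} {Z W : Over (Spec (.of k))}

lemma pull_actPt (t : Z ⟶ torus k n) (u : Z ⟶ affineOver k σ) (m : dualMonoid σ) (c : k) :
    pull (actPt t u).left (AddMonoidAlgebra.single m c) =
      pull t.left (AddMonoidAlgebra.single (m : Fin n → ℤ) 1) *
        pull u.left (AddMonoidAlgebra.single m c) := by
  rw [← actRingHom_single]
  exact RingHom.congr_fun (pull_ofPull _) _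

lemma affineOver_hom_ext {u u' : Z ⟶ affineOver k σ}
    (h : ∀ m c, pull u.left (AddMonoidAlgebra.single m c) =
      pull u'.left (AddMonoidAlgebra.single m c)) : u = u' := by
  ext1
  exact pull_injective (coordRing_ringHom_ext h)

lemma pull_comp_apply {Z W : Scheme.{u}} {A : Type u} [CommRing A] (g : W ⟶ Z)
    (f : Z ⟶ Spec (.of A)) (a : A) : pull (g ≫ f) a = g.appTop.hom (pull f a) := by
  rw [pull_comp]; rfl

lemma comp_actPt (h : W ⟶ Z) (t : Z ⟶ torus k n) (u : Z ⟶ affineOver k σ) :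
    h ≫ actPt t u = actPt (h ≫ t) (h ≫ u) := by
  refine affineOver_hom_ext fun m c => ?_
  rw [pull_actPt, Over.comp_left, Over.comp_left, Over.comp_left]
  refine (pull_comp_apply h.left (actPt t u).left _).trans ?_
  rw [pull_actPt, map_mul]
  exact congrArg₂ _ (pull_comp_apply h.left t.left _).symm (pull_comp_apply h.left u.left _).symm

/-- The morphism `U_τ → U_σ` over `Spec k`. -/
def affineMapOver (h : τ ≤ σ) : affineOver k τ ⟶ affineOver k σ :=
  Over.homMk (affineMap k h) (by
    change Spec.map _ ≫ Spec.map _ = Spec.map _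
    rw [← Spec.map_comp, ← CommRingCat.ofHom_comp]
    congr 2
    ext
    simp [coordRingMap])

lemma actPt_affineMapOver (h : τ ≤ σ) (t : Z ⟶ torus k n) (u : Z ⟶ affineOver k τ) :
    actPt t (u ≫ affineMapOver h) = actPt t u ≫ affineMapOver h := by
  have key : ∀ (v : Z ⟶ affineOver k τ) m c,
      pull (v ≫ affineMapOver h).left (AddMonoidAlgebra.single m c) = pull v.left
        (AddMonoidAlgebra.single (AddSubmonoid.inclusion (dualMonoid_anti h) m) c) := by
    intro v m c
    rw [← coordRingMap_single]
    exact RingHom.congr_fun (pull_comp_SpecMap v.left (coordRingMap k h)) _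
  refine affineOver_hom_ext fun m c => ?_
  rw [key, pull_actPt, pull_actPt, key]
  rfl

lemma pull_lift_mul (t t' : Z ⟶ torus k n) (m : Fin n → ℤ) :
    pull (lift t t' ≫ MonObj.mul).left (AddMonoidAlgebra.single m (1 : k)) =
      pull t.left (AddMonoidAlgebra.single m 1) * pull t'.left (AddMonoidAlgebra.single m 1) := by
  let A := AddMonoidAlgebra k (Fin n → ℤ)
  let w : Z.left ⟶ Spec (.of (TensorProduct k A A)) := (lift t t').left ≫ (pullbackSpecIso k A A).hom
  have h : (lift t t' ≫ MonObj.mul).left =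
      w ≫ Spec.map (CommRingCat.ofHom (Bialgebra.comulAlgHom k A : A →+* TensorProduct k A A)) := by
    rw [Over.comp_left, mul_spec_asOver_spec_left]
    exact (Category.assoc _ _ _).symm
  have h1 : w ≫ Spec.map (CommRingCat.ofHom
      (Algebra.TensorProduct.includeLeftRingHom : A →+* TensorProduct k A A)) = t.left := by
    refine (Category.assoc _ _ _).trans ?_
    refine (congrArg (fun q => (lift t t').left ≫ q) (pullbackSpecIso_hom_fst k A A)).trans ?_
    exact congrArg (·.left) (lift_fst t t')
  have h2 : w ≫ Spec.map (CommRingCat.ofHom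
      (Algebra.TensorProduct.includeRight : A →ₐ[k] TensorProduct k A A).toRingHom) = t'.left := by
    refine (Category.assoc _ _ _).trans ?_
    refine (congrArg (fun q => (lift t t').left ≫ q) (pullbackSpecIso_hom_snd k A A)).trans ?_
    exact congrArg (·.left) (lift_snd t t')
  rw [h, pull_comp_SpecMap, ← h1, ← h2, pull_comp_SpecMap, pull_comp_SpecMap]
  simp only [RingHom.comp_apply]
  rw [← map_mul]
  congr 1
  change Coalgebra.comul (R := k) (AddMonoidAlgebra.single m (1 : k)) = _
  rw [AddMonoidAlgebra.comul_single]
  simp [A]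

lemma pull_one (m : Fin n → ℤ) :
    pull (toUnit Z ≫ MonObj.one (X := torus k n)).left (AddMonoidAlgebra.single m (1 : k)) = 1 := by
  let A := AddMonoidAlgebra k (Fin n → ℤ)
  have h : (toUnit Z ≫ MonObj.one (X := torus k n)).left = Z.hom ≫
      Spec.map (CommRingCat.ofHom (Bialgebra.counitAlgHom k A : A →+* k)) := rfl
  rw [h, pull_comp_SpecMap]
  simp only [RingHom.comp_apply]
  have : (Bialgebra.counitAlgHom k A : A →+* k) (AddMonoidAlgebra.single m 1) = 1 := by
    change Coalgebra.counit (R := k) (AddMonoidAlgebra.single m (1 : k)) = _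
    rw [AddMonoidAlgebra.counit_single]
    simp
  rw [this, map_one]

end Action
end Toric

namespace Toric

section GlobalAction

open MonoidalCategory CartesianMonoidalCategory

variable (k : Type u) [Field k] {n : ℕ} (Δ : Fan n)

/-- For `Z → X_Δ` over `Spec k`, the preimage of `U_σ` in `Z`. -/
def piece {Z : Over (Spec (.of k))} (q : Z ⟶ toricOver k Δ) (σ : Δ.cones) : Over (Spec (.of k)) :=
  Over.mk (pullback.fst q.left (chart k Δ σ) ≫ Z.hom)

/-- The inclusion of the preimage of `U_σ`. -/
def pieceIncl {Z : Over (Spec (.of k))} (q : Z ⟶ toricOver k Δ) (σ : Δ.cones) :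
    piece k Δ q σ ⟶ Z :=
  Over.homMk (pullback.fst q.left (chart k Δ σ)) rfl

/-- The morphism from the preimage of `U_σ` to `U_σ`. -/
def pieceProj {Z : Over (Spec (.of k))} (q : Z ⟶ toricOver k Δ) (σ : Δ.cones) :
    piece k Δ q σ ⟶ affineOver k σ.1 :=
  Over.homMk (pullback.snd q.left (chart k Δ σ)) (by
    rw [← chart_toricHom]
    refine (pullback.condition_assoc _).symm.trans ?_
    exact congrArg (pullback.fst q.left (chart k Δ σ) ≫ ·) (Over.w q))

lemma piece_condition {Z : Over (Spec (.of k))} (q : Z ⟶ toricOver k Δ) (σ : Δ.cones) :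
    pieceIncl k Δ q σ ≫ q = pieceProj k Δ q σ ≫ chartOver k Δ σ := by
  apply Over.OverMorphism.ext
  exact pullback.condition

/-- The cover of `Z` by the preimages of the `U_σ`. -/
def pieceCover {Z : Over (Spec (.of k))} (q : Z ⟶ toricOver k Δ) : Z.left.OpenCover :=
  (toricCover k Δ).pullback₁ q.left

instance {Z : Over (Spec (.of k))} (q : Z ⟶ toricOver k Δ) : Category (pieceCover k Δ q).I₀ :=
  inferInstanceAs (Category Δ.cones)

instance {Z : Over (Spec (.of k))} (q : Z ⟶ toricOver k Δ) : (pieceCover k Δ q).LocallyDirected :=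
  Scheme.Cover.locallyDirectedPullbackCover (toricCover k Δ) q.left

lemma piece_hom_ext {Z Y : Over (Spec (.of k))} (q : Z ⟶ toricOver k Δ) {f g : Z ⟶ Y}
    (h : ∀ σ, pieceIncl k Δ q σ ≫ f = pieceIncl k Δ q σ ≫ g) : f = g := by
  apply Over.OverMorphism.ext
  exact Scheme.Cover.hom_ext (pieceCover k Δ q) _ _
    fun σ => congrArg (·.left) (h σ)

/-- The transition maps between the preimages of `U_τ` and `U_σ` for `τ ⊆ σ`. -/
def pieceTrans {Z : Over (Spec (.of k))} (q : Z ⟶ toricOver k Δ) {σ τ : Δ.cones} (f : σ ⟶ τ) :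
    piece k Δ q σ ⟶ piece k Δ q τ :=
  Over.homMk ((pieceCover k Δ q).trans (i := σ) (j := τ) f) (by
    refine (Category.assoc _ _ _).symm.trans ?_
    exact congrArg (· ≫ Z.hom) ((pieceCover k Δ q).trans_map (i := σ) (j := τ) f))

lemma pieceTrans_incl {Z : Over (Spec (.of k))} (q : Z ⟶ toricOver k Δ) {σ τ : Δ.cones}
    (f : σ ⟶ τ) : pieceTrans k Δ q f ≫ pieceIncl k Δ q τ = pieceIncl k Δ q σ :=
  Over.OverMorphism.ext ((pieceCover k Δ q).trans_map (i := σ) (j := τ) f)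

lemma pieceTrans_proj {Z : Over (Spec (.of k))} (q : Z ⟶ toricOver k Δ) {σ τ : Δ.cones}
    (f : σ ⟶ τ) : pieceTrans k Δ q f ≫ pieceProj k Δ q τ =
      pieceProj k Δ q σ ≫ affineMapOver (leOfHom f) :=
  Over.OverMorphism.ext (by
    change pullback.map q.left (chart k Δ σ) q.left (chart k Δ τ) (𝟙 _) (affineMap k (leOfHom f))
      (𝟙 _) (by simp) (by rw [Category.comp_id]; exact (affineMap_chart k Δ _).symm) ≫
        pullback.snd _ _ = pullback.snd _ _ ≫ affineMap k _
    exact pullback.lift_snd _ _ _)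

lemma affineMapOver_chartOver {σ τ : Δ.cones} (h : σ.1 ≤ τ.1) :
    affineMapOver h ≫ chartOver k Δ τ = chartOver k Δ σ :=
  Over.OverMorphism.ext (affineMap_chart k Δ h)

/-- The restriction of the action to `T × U_σ`: it is the action of `T` on `U_σ`. -/
def actPiece (σ : Δ.cones) :
    piece k Δ (snd (torus k n) (toricOver k Δ)) σ ⟶ toricOver k Δ :=
  actPt (pieceIncl k Δ (snd (torus k n) (toricOver k Δ)) σ ≫ fst _ _)
    (pieceProj k Δ (snd (torus k n) (toricOver k Δ)) σ) ≫ chartOver k Δ σ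

lemma pieceTrans_actPiece {σ τ : Δ.cones} (f : σ ⟶ τ) :
    pieceTrans k Δ (snd (torus k n) (toricOver k Δ)) f ≫ actPiece k Δ τ = actPiece k Δ σ := by
  rw [actPiece, actPiece, ← Category.assoc, comp_actPt, ← Category.assoc, pieceTrans_incl,
    pieceTrans_proj, actPt_affineMapOver, Category.assoc, affineMapOver_chartOver]

/-- The action `T × X_Δ → X_Δ`, glued from the actions `T × U_σ → U_σ`. -/
def torusAct : torus k n ⊗ toricOver k Δ ⟶ toricOver k Δ :=
  Scheme.OpenCover.glueMorphismsOverOfLocallyDirected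
    (pieceCover k Δ (snd (torus k n) (toricOver k Δ)))
    (fun σ => (actPiece k Δ σ).left)
    (fun f => congrArg (·.left) (pieceTrans_actPiece k Δ f))
    (fun σ => Over.w (actPiece k Δ σ))

lemma pieceIncl_torusAct (σ : Δ.cones) :
    pieceIncl k Δ (snd (torus k n) (toricOver k Δ)) σ ≫ torusAct k Δ = actPiece k Δ σ :=
  Over.OverMorphism.ext (Scheme.OpenCover.map_glueMorphismsOverOfLocallyDirected_left
    (pieceCover k Δ (snd (torus k n) (toricOver k Δ))) (fun σ => (actPiece k Δ σ).left)
    (fun f => congrArg (·.left) (pieceTrans_actPiece k Δ f))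
    (fun σ => Over.w (actPiece k Δ σ)) σ)

/-- The morphism to the preimage of `U_σ` given by morphisms to `Z` and to `U_σ`. -/
def pieceLift {Z W : Over (Spec (.of k))} (q : Z ⟶ toricOver k Δ) {σ : Δ.cones} (f : W ⟶ Z)
    (u : W ⟶ affineOver k σ.1) (h : f ≫ q = u ≫ chartOver k Δ σ) : W ⟶ piece k Δ q σ :=
  Over.homMk (pullback.lift f.left u.left (congrArg (·.left) h)) (by
    refine (pullback.lift_fst_assoc _ _ _ _).trans ?_
    exact Over.w f)

lemma pieceLift_incl {Z W : Over (Spec (.of k))} (q : Z ⟶ toricOver k Δ) {σ : Δ.cones}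
    (f : W ⟶ Z) (u : W ⟶ affineOver k σ.1) (h : f ≫ q = u ≫ chartOver k Δ σ) :
    pieceLift k Δ q f u h ≫ pieceIncl k Δ q σ = f :=
  Over.OverMorphism.ext (pullback.lift_fst _ _ _)

lemma pieceLift_proj {Z W : Over (Spec (.of k))} (q : Z ⟶ toricOver k Δ) {σ : Δ.cones}
    (f : W ⟶ Z) (u : W ⟶ affineOver k σ.1) (h : f ≫ q = u ≫ chartOver k Δ σ) :
    pieceLift k Δ q f u h ≫ pieceProj k Δ q σ = u :=
  Over.OverMorphism.ext (pullback.lift_snd _ _ _)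

/-- On points of `T` and `U_σ ⊆ X_Δ`, the action on `X_Δ` is the one of `T` on `U_σ`. -/
lemma lift_torusAct {Z : Over (Spec (.of k))} {σ : Δ.cones} (t : Z ⟶ torus k n)
    (u : Z ⟶ affineOver k σ.1) :
    lift t (u ≫ chartOver k Δ σ) ≫ torusAct k Δ = actPt t u ≫ chartOver k Δ σ := by
  have h := lift_snd t (u ≫ chartOver k Δ σ)
  rw [← pieceLift_incl k Δ _ _ _ h, Category.assoc, pieceIncl_torusAct, actPiece,
    ← Category.assoc, comp_actPt, ← Category.assoc, pieceLift_incl, pieceLift_proj, lift_fst]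

/-- The action of the torus `T` on the toric variety `X_Δ`. -/
instance torusModObj : ModObj (torus k n) (toricOver k Δ) where
  smul := torusAct k Δ
  one_smul := by
    change (MonObj.one ▷ toricOver k Δ) ≫ torusAct k Δ = (λ_ (toricOver k Δ)).hom
    refine piece_hom_ext k Δ (λ_ (toricOver k Δ)).hom fun σ => ?_
    have hc := piece_condition k Δ (λ_ (toricOver k Δ)).hom σ
    have h : pieceIncl k Δ (λ_ (toricOver k Δ)).hom σ ≫ (MonObj.one ▷ toricOver k Δ) =
        lift (toUnit _ ≫ MonObj.one (X := torus k n))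
          (pieceProj k Δ (λ_ (toricOver k Δ)).hom σ ≫ chartOver k Δ σ) := by
      rw [← hc]
      apply CartesianMonoidalCategory.hom_ext
      · rw [lift_fst, Category.assoc, whiskerRight_fst, ← Category.assoc]
        exact congrArg (· ≫ _) (toUnit_unique _ _)
      · rw [lift_snd, Category.assoc, whiskerRight_snd, leftUnitor_hom]
    rw [← Category.assoc, h, lift_torusAct, hc]
    congr 1
    refine affineOver_hom_ext fun m c => ?_
    rw [pull_actPt, pull_one, one_mul]
  mul_smul := by
    change (MonObj.mul ▷ toricOver k Δ) ≫ torusAct k Δ =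
      (α_ (torus k n) (torus k n) (toricOver k Δ)).hom ≫ (torus k n ◁ torusAct k Δ) ≫ torusAct k Δ
    let q := snd (torus k n ⊗ torus k n) (toricOver k Δ)
    refine piece_hom_ext k Δ q fun σ => ?_
    have hc := piece_condition k Δ q σ
    let t := pieceIncl k Δ q σ ≫ fst _ _ ≫ fst _ _
    let t' := pieceIncl k Δ q σ ≫ fst _ _ ≫ snd _ _
    let u := pieceProj k Δ q σ
    have h1 : pieceIncl k Δ q σ ≫ (MonObj.mul ▷ toricOver k Δ) =
        lift (lift t t' ≫ MonObj.mul) (u ≫ chartOver k Δ σ) := by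
      rw [← hc]
      apply CartesianMonoidalCategory.hom_ext
      · rw [lift_fst, Category.assoc, whiskerRight_fst, ← Category.assoc]
        congr 1
        apply CartesianMonoidalCategory.hom_ext
        · rw [lift_fst, Category.assoc]
        · rw [lift_snd, Category.assoc]
      · rw [lift_snd, Category.assoc, whiskerRight_snd]
    have h2 : pieceIncl k Δ q σ ≫ (α_ (torus k n) (torus k n) (toricOver k Δ)).hom ≫
        (torus k n ◁ torusAct k Δ) = lift t (actPt t' u ≫ chartOver k Δ σ) := by
      rw [← lift_torusAct, ← hc]
      apply CartesianMonoidalCategory.hom_ext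
      · rw [lift_fst, Category.assoc, Category.assoc, whiskerLeft_fst, associator_hom_fst]
      · have h3 : (α_ (torus k n) (torus k n) (toricOver k Δ)).hom ≫ snd _ _ =
            lift (fst _ _ ≫ snd _ _) q := by
          apply CartesianMonoidalCategory.hom_ext
          · rw [lift_fst, Category.assoc, associator_hom_snd_fst]
          · rw [lift_snd, Category.assoc, associator_hom_snd_snd]
        rw [lift_snd, Category.assoc, Category.assoc, whiskerLeft_snd, ← Category.assoc _ _
          (torusAct k Δ), h3, ← Category.assoc, comp_lift]
    rw [← Category.assoc, h1, lift_torusAct]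
    rw [← Category.assoc (α_ (torus k n) (torus k n) (toricOver k Δ)).hom, ← Category.assoc, h2,
      lift_torusAct]
    congr 1
    refine affineOver_hom_ext fun m c => ?_
    rw [pull_actPt, pull_actPt, pull_actPt, pull_lift_mul, mul_assoc]

end GlobalAction
end Toric

namespace Toric

section Linearization

open MonoidalCategory CartesianMonoidalCategory

variable {S : Scheme.{u}} (G X : Over S) [GrpObj G]

/-- The action `a : G × X → X`. -/
abbrev actMap [ModObj G X] : G ⊗ X ⟶ X := ModObj.smul (M := G) (X := X)

/-- The projection `p : G × X → X`. -/
abbrev projMap : G ⊗ X ⟶ X := snd G X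

/-- The morphism `μ × id : G × (G × X) → G × X`. -/
abbrev mulFace : G ⊗ (G ⊗ X) ⟶ G ⊗ X := (α_ G G X).inv ≫ MonObj.mul ▷ X

/-- The morphism `id × a : G × (G × X) → G × X`. -/
abbrev actFace [ModObj G X] : G ⊗ (G ⊗ X) ⟶ G ⊗ X := G ◁ actMap G X

/-- The projection of `G × (G × X)` to the last two factors. -/
abbrev projFace : G ⊗ (G ⊗ X) ⟶ G ⊗ X := snd G (G ⊗ X)

lemma mulFace_actMap [ModObj G X] : mulFace G X ≫ actMap G X = actFace G X ≫ actMap G X := by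
  rw [Category.assoc]
  exact (ModObj.assoc_flip (M := G) X).symm

lemma actFace_projMap [ModObj G X] : actFace G X ≫ projMap G X = projFace G X ≫ actMap G X :=
  whiskerLeft_snd _ _

lemma mulFace_projMap : mulFace G X ≫ projMap G X = projFace G X ≫ projMap G X := by
  rw [Category.assoc, whiskerRight_snd, associator_inv_snd]

/-- The pullback `h^*φ : (f ∘ h)^*E → (g ∘ h)^*E` of a morphism `φ : f^*E → g^*E`. -/
def pullHom {W Y Z : Scheme.{u}} (h : W ⟶ Y) {f g : Y ⟶ Z} {E : Z.Modules}
    (φ : (Scheme.Modules.pullback f).obj E ⟶ (Scheme.Modules.pullback g).obj E) :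
    (Scheme.Modules.pullback (h ≫ f)).obj E ⟶ (Scheme.Modules.pullback (h ≫ g)).obj E :=
  (Scheme.Modules.pullbackComp h f).inv.app E ≫ (Scheme.Modules.pullback h).map φ ≫
    (Scheme.Modules.pullbackComp h g).hom.app E

/-- For `φ : a^*E → p^*E`, the identity `m^*φ = q^*φ ∘ d^*φ` of morphisms
`m^*a^*E = d^*a^*E → d^*p^*E = q^*a^*E → q^*p^*E = m^*p^*E`. -/
def IsCocycle {W Y Z : Scheme.{u}} {a p : Y ⟶ Z} {m d q : W ⟶ Y} (h₁ : m ≫ a = d ≫ a)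
    (h₂ : d ≫ p = q ≫ a) (h₃ : q ≫ p = m ≫ p) {E : Z.Modules}
    (φ : (Scheme.Modules.pullback a).obj E ⟶ (Scheme.Modules.pullback p).obj E) : Prop :=
  pullHom m φ = (Scheme.Modules.pullbackCongr h₁).hom.app E ≫ pullHom d φ ≫
    (Scheme.Modules.pullbackCongr h₂).hom.app E ≫ pullHom q φ ≫
    (Scheme.Modules.pullbackCongr h₃).hom.app E

/-- A `G`-linearization of a sheaf of modules `E` on `X`: an isomorphism `Φ : a^*E ≅ p^*E` on
`G × X` satisfying the cocycle condition `(μ × id)^*Φ = p₂₃^*Φ ∘ (id × a)^*Φ` on `G × G × X`. -/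
structure Linearization [ModObj G X] (E : X.left.Modules) where
  iso : (Scheme.Modules.pullback (actMap G X).left).obj E ≅
    (Scheme.Modules.pullback (projMap G X).left).obj E
  cocycle : IsCocycle (m := (mulFace G X).left) (d := (actFace G X).left)
    (q := (projFace G X).left) (congrArg (·.left) (mulFace_actMap G X))
    (congrArg (·.left) (actFace_projMap G X)) (congrArg (·.left) (mulFace_projMap G X).symm)
    iso.hom

/-- A `G`-equivariant quasicoherent sheaf on `X`. -/
structure EquivariantQCoh [ModObj G X] where
  sheaf : X.left.Modules
  quasicoherent : SheafOfModules.IsQuasicoherent.{u} sheaf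
  linearization : Linearization G X sheaf

/-- A sheaf of modules on a (locally noetherian) scheme is coherent if it is quasicoherent and its
sections on the members of some affine open cover form finitely generated modules. -/
def IsCoherent {X : Scheme.{u}} (E : X.Modules) : Prop :=
  SheafOfModules.IsQuasicoherent.{u} E ∧
    ∀ x : X, ∃ U : X.Opens, x ∈ U ∧ IsAffineOpen U ∧ Module.Finite Γ(X, U) Γ(E, U)

end Linearization
end Toric

namespace Toric

section Families

variable {n : ℕ}

/-- The preorder `m ≤_σ m'`, i.e. `m' - m ∈ σ_M`. -/
def LeCone (σ : PointedCone ℝ (Fin n → ℝ)) (m m' : Fin n → ℤ) : Prop := m' - m ∈ dualMonoid σ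

/-- The strict order `m <_σ m'`, i.e. `m ≤_σ m'` and not `m' ≤_σ m`. -/
def LtCone (σ : PointedCone ℝ (Fin n → ℝ)) (m m' : Fin n → ℤ) : Prop :=
  LeCone σ m m' ∧ ¬ LeCone σ m' m

lemma LeCone.refl (σ : PointedCone ℝ (Fin n → ℝ)) (m : Fin n → ℤ) : LeCone σ m m := by
  rw [LeCone, sub_self]; exact zero_mem _

lemma LeCone.trans {σ : PointedCone ℝ (Fin n → ℝ)} {m m' m'' : Fin n → ℤ} (h : LeCone σ m m')
    (h' : LeCone σ m' m'') : LeCone σ m m'' := by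
  rw [LeCone, ← sub_add_sub_cancel m'' m' m]; exact add_mem h' h

/-- A `σ`-family: vector spaces `E_m` for `m ∈ M` and linear maps `χ_{m,m'} : E_m → E_{m'}` for
`m ≤_σ m'`, compatible with identities and compositions. -/
structure SigmaFamily (k : Type u) [Field k] (σ : PointedCone ℝ (Fin n → ℝ)) where
  space : (Fin n → ℤ) → Type u
  [group : ∀ m, AddCommGroup (space m)]
  [module : ∀ m, Module k (space m)]
  map : ∀ {m m'}, LeCone σ m m' → space m →ₗ[k] space m'
  map_refl : ∀ m, map (LeCone.refl σ m) = LinearMap.id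
  map_trans : ∀ {m m' m''} (h : LeCone σ m m') (h' : LeCone σ m' m''),
    map (h.trans h') = map h' ∘ₗ map h

attribute [instance] SigmaFamily.group SigmaFamily.module

/-- Finiteness of a `σ`-family `E`:
(i) all `E_m` are finite-dimensional;
(ii) for each chain `⋯ <_σ m_{i-1} <_σ m_i <_σ ⋯` one has `E_{m_i} = 0` for all small enough `i`;
(iii) the `m` for which the sum `⨁_{m' <_σ m} E_{m'} → E_m` of the `χ_{m',m}` is not surjective
form only finitely many classes modulo `σ_M^⊥`. -/
structure SigmaFamily.IsFinite {k : Type u} [Field k] {σ : PointedCone ℝ (Fin n → ℝ)}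
    (E : SigmaFamily k σ) : Prop where
  finite_dimensional : ∀ m, Module.Finite k (E.space m)
  chain : ∀ c : ℤ → (Fin n → ℤ), (∀ i, LtCone σ (c (i - 1)) (c i)) →
    ∃ i₀, ∀ i < i₀, Subsingleton (E.space (c i))
  generated : ((fun m : Fin n → ℤ => (m : (Fin n → ℤ) ⧸ perp σ)) ''
    {m | (⨆ (m') (h : LtCone σ m' m), LinearMap.range (E.map h.1)) ≠ ⊤}).Finite

end Families

section PullbackSections

/-- The pullback `f^*s` of a section `s` of `E` on `U`, as a section of `f^*E` on `V ⊆ f⁻¹(U)`. -/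
def pullSec {Y Z : Scheme.{u}} (f : Y ⟶ Z) (E : Z.Modules) (U : Z.Opens) (V : Y.Opens)
    (h : V ≤ f ⁻¹ᵁ U) : Γ(E, U) →+ Γ((Scheme.Modules.pullback f).obj E, V) :=
  (((Scheme.Modules.pullback f).obj E).presheaf.map (homOfLE h).op).hom.comp
    (((Scheme.Modules.pullbackPushforwardAdjunction f).unit.app E).app U).hom

lemma pullSec_smul {Y Z : Scheme.{u}} (f : Y ⟶ Z) (E : Z.Modules) (U : Z.Opens) (V : Y.Opens)
    (h : V ≤ f ⁻¹ᵁ U) (r : Γ(Z, U)) (s : Γ(E, U)) :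
    pullSec f E U V h (r • s) = f.appLE U V h r • pullSec f E U V h s := by
  have h1 := Scheme.Modules.Hom.app_smul
    ((Scheme.Modules.pullbackPushforwardAdjunction f).unit.app E) r s
  refine (congrArg (((Scheme.Modules.pullback f).obj E).presheaf.map (homOfLE h).op) h1).trans ?_
  exact Scheme.Modules.map_smul ((Scheme.Modules.pullback f).obj E) (homOfLE h) (f.app U r) _

end PullbackSections

section OpenAffine

variable {A : Type u} [CommRing A] {X : Scheme.{u}} (c : Spec (.of A) ⟶ X) [IsOpenImmersion c]

/-- For an open immersion `Spec A → X`, the identification of `A` with the functions on its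
image. -/
def openFun : A →+* Γ(X, c.opensRange) :=
  c.opensRange.topIso.hom.hom.comp (pull c.isoOpensRange.inv)

lemma appTop_eq_appLE {Y Z : Scheme.{u}} (f : Y ⟶ Z) (h : ⊤ ≤ f ⁻¹ᵁ ⊤) :
    f.appTop = f.appLE ⊤ ⊤ h :=
  Scheme.Hom.app_eq_appLE f

lemma appLE_openFun {Z : Scheme.{u}} (u : Z ⟶ Spec (.of A)) (a : A)
    (h : ⊤ ≤ (u ≫ c) ⁻¹ᵁ c.opensRange) :
    (u ≫ c).appLE c.opensRange ⊤ h (openFun c a) = pull u a := by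
  have h2 : (u ≫ c).appLE c.opensRange ⊤ h =
      c.opensRange.topIso.inv ≫ (u ≫ c.isoOpensRange.hom).appTop := by
    have h3 : c.opensRange.topIso.inv = c.opensRange.ι.appLE c.opensRange ⊤ (by simp) := by
      simp only [Scheme.Opens.topIso_inv, Scheme.Hom.appLE, Scheme.Opens.ι_app]
      exact (congrArg X.presheaf.map (Subsingleton.elim _ _)).trans (X.presheaf.map_comp _ _)
    have h5 := Scheme.Hom.appLE_comp_appLE (u ≫ c.isoOpensRange.hom) c.opensRange.ι
      c.opensRange ⊤ ⊤ (by simp) le_top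
    rw [h3, appTop_eq_appLE _ le_top]
    refine Eq.trans ?_ h5.symm
    congr 1
    rw [Category.assoc, Scheme.Hom.isoOpensRange_hom_ι]
  have h1 : u = (u ≫ c.isoOpensRange.hom) ≫ c.isoOpensRange.inv := by simp
  conv_rhs => rw [h1, pull_comp_apply]
  rw [h2]
  change ((u ≫ c.isoOpensRange.hom).appTop.hom (c.opensRange.topIso.inv
    (c.opensRange.topIso.hom _))) = _
  rw [Iso.hom_inv_id_apply]

end OpenAffine

section Associated

open MonoidalCategory CartesianMonoidalCategory

variable (k : Type u) [Field k] {n : ℕ} (Δ : Fan n) (σ : Δ.cones)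

/-- `U_σ` as an open subset of `X_Δ`. -/
def chartOpen : (toricOver k Δ).left.Opens := (chart k Δ σ).opensRange

/-- The identification of `k[σ_M]` with the functions on `U_σ ⊆ X_Δ`. -/
def coord : CoordRing k σ.1 →+* Γ((toricOver k Δ).left, chartOpen k Δ σ) :=
  openFun (chart k Δ σ)

lemma le_preimage_chartOpen {Z : Scheme.{u}} {f : Z ⟶ toricScheme k Δ}
    {u : Z ⟶ Spec (.of (CoordRing k σ.1))} (hf : f = u ≫ chart k Δ σ) :
    ⊤ ≤ f ⁻¹ᵁ chartOpen k Δ σ := by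
  intro z _
  exact ⟨u z, by rw [hf]; rfl⟩

lemma appLE_coord {Z : Scheme.{u}} {f : Z ⟶ toricScheme k Δ}
    {u : Z ⟶ Spec (.of (CoordRing k σ.1))} (hf : f = u ≫ chart k Δ σ) (a : CoordRing k σ.1)
    (h : ⊤ ≤ f ⁻¹ᵁ chartOpen k Δ σ) :
    f.appLE (chartOpen k Δ σ) ⊤ h (coord k Δ σ a) = pull u a := by
  subst hf
  exact appLE_openFun _ _ _ _

/-- The open subset `T × U_σ` of `T × X_Δ`. -/
def prodOpen : (torus k n ⊗ toricOver k Δ).left.Opens :=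
  (projMap (torus k n) (toricOver k Δ)).left ⁻¹ᵁ chartOpen k Δ σ

lemma range_pieceIncl : Set.range (pieceIncl k Δ (snd (torus k n) (toricOver k Δ)) σ).left =
    prodOpen k Δ σ := by
  exact (Scheme.Pullback.range_fst _ _)

instance : IsOpenImmersion (pieceIncl k Δ (snd (torus k n) (toricOver k Δ)) σ).left :=
  inferInstanceAs (IsOpenImmersion (pullback.fst _ _))

lemma prodOpen_le : prodOpen k Δ σ ≤
    (actMap (torus k n) (toricOver k Δ)).left ⁻¹ᵁ chartOpen k Δ σ := by
  intro x hx
  have hx : x ∈ Set.range (pieceIncl k Δ (snd (torus k n) (toricOver k Δ)) σ).left := by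
    rw [range_pieceIncl]; exact hx
  obtain ⟨z, rfl⟩ := hx
  have h := congrArg (·.left) (pieceIncl_torusAct k Δ σ)
  exact le_preimage_chartOpen k Δ σ (f := (pieceIncl k Δ _ σ).left ≫ (torusAct k Δ).left) h
    (Set.mem_univ z)

/-- The function `χ(m)` on `T`, pulled back to `T × U_σ`. -/
def charFun (m : Fin n → ℤ) : Γ((torus k n ⊗ toricOver k Δ).left, prodOpen k Δ σ) :=
  (torus k n ⊗ toricOver k Δ).left.presheaf.map (homOfLE le_top).op
    (pull (fst (torus k n) (toricOver k Δ)).left (AddMonoidAlgebra.single m 1))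

lemma charFun_add (m d : Fin n → ℤ) :
    charFun k Δ σ (m + d) = charFun k Δ σ m * charFun k Δ σ d := by
  rw [charFun, charFun, charFun, ← map_mul, ← map_mul, AddMonoidAlgebra.single_mul_single, one_mul]

lemma charFun_zero : charFun k Δ σ 0 = 1 := by
  rw [charFun, ← AddMonoidAlgebra.one_def, map_one, map_one]

/-- On functions, the action is given by `χ(d) ↦ χ(d) ⊗ χ(d)`. -/
lemma act_coord (d : dualMonoid σ.1) (c : k) :
    (actMap (torus k n) (toricOver k Δ)).left.appLE (chartOpen k Δ σ) (prodOpen k Δ σ)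
      (prodOpen_le k Δ σ) (coord k Δ σ (AddMonoidAlgebra.single d c)) =
    charFun k Δ σ d * (projMap (torus k n) (toricOver k Δ)).left.appLE (chartOpen k Δ σ)
      (prodOpen k Δ σ) le_rfl (coord k Δ σ (AddMonoidAlgebra.single d c)) := by
  let P := snd (torus k n) (toricOver k Δ)
  let j := (pieceIncl k Δ P σ).left
  have hj : ⊤ ≤ j ⁻¹ᵁ prodOpen k Δ σ := fun z _ => by
    have : j z ∈ Set.range j := ⟨z, rfl⟩
    rw [range_pieceIncl] at this
    exact this
  have hinj : Function.Injective (j.appLE (prodOpen k Δ σ) ⊤ hj) := by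
    have h1 : j ⁻¹ᵁ prodOpen k Δ σ = ⊤ := top_le_iff.1 hj
    have : IsIso (j.app (prodOpen k Δ σ)) := Scheme.Hom.isIso_app j _ (by
      intro x hx
      have : x ∈ Set.range j := by rw [range_pieceIncl]; exact hx
      exact this)
    have : IsIso (j.appLE (prodOpen k Δ σ) ⊤ hj) := by
      have h2 : IsIso (homOfLE hj).op := by
        have : IsIso (homOfLE hj) := ⟨homOfLE h1.le, Subsingleton.elim _ _, Subsingleton.elim _ _⟩
        infer_instance
      rw [Scheme.Hom.appLE]
      infer_instance
    exact ((ConcreteCategory.isIso_iff_bijective _).1 this).1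
  apply hinj
  rw [map_mul]
  have e1 := Scheme.Hom.appLE_comp_appLE j (actMap (torus k n) (toricOver k Δ)).left
    (chartOpen k Δ σ) (prodOpen k Δ σ) ⊤ (prodOpen_le k Δ σ) hj
  have e2 := Scheme.Hom.appLE_comp_appLE j (projMap (torus k n) (toricOver k Δ)).left
    (chartOpen k Δ σ) (prodOpen k Δ σ) ⊤ le_rfl hj
  have f1 := ConcreteCategory.congr_hom e1 (coord k Δ σ (AddMonoidAlgebra.single d c))
  have f2 := ConcreteCategory.congr_hom e2 (coord k Δ σ (AddMonoidAlgebra.single d c))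
  have g1 := appLE_coord k Δ σ (congrArg (·.left) (pieceIncl_torusAct k Δ σ))
    (AddMonoidAlgebra.single d c) (le_preimage_chartOpen k Δ σ
      (congrArg (·.left) (pieceIncl_torusAct k Δ σ)))
  have g2 := appLE_coord k Δ σ (congrArg (·.left) (piece_condition k Δ P σ))
    (AddMonoidAlgebra.single d c) (le_preimage_chartOpen k Δ σ
      (congrArg (·.left) (piece_condition k Δ P σ)))
  have g3 : j.appLE (prodOpen k Δ σ) ⊤ hj (charFun k Δ σ d) =
      pull (pieceIncl k Δ P σ ≫ fst _ _).left (AddMonoidAlgebra.single (d : Fin n → ℤ) (1 : k)) := by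
    refine Eq.trans ?_ (pull_comp_apply j (fst (torus k n) (toricOver k Δ)).left _).symm
    have := Scheme.Hom.map_appLE j hj (homOfLE (le_top : prodOpen k Δ σ ≤ ⊤)).op
    refine (ConcreteCategory.congr_hom this _).trans ?_
    exact (ConcreteCategory.congr_hom (appTop_eq_appLE j _) _).symm
  refine f1.trans (g1.trans ?_)
  refine Eq.trans ?_ (congrArg₂ (· * ·) g3 (f2.trans g2)).symm
  exact pull_actPt _ _ _ _

end Associated
end Toric

namespace Toric

section Weights

open MonoidalCategory CartesianMonoidalCategory

variable {k : Type u} [Field k] {n : ℕ} {Δ : Fan n}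
  (E : EquivariantQCoh (torus k n) (toricOver k Δ)) (σ : Δ.cones)

/-- The sections `Γ(U_σ, E)`. -/
def ChartSections : Type u := Γ(E.sheaf, chartOpen k Δ σ)

instance : AddCommGroup (ChartSections E σ) :=
  inferInstanceAs (AddCommGroup Γ(E.sheaf, chartOpen k Δ σ))

/-- `Γ(U_σ, E)` is a module over `k[σ_M]`. -/
instance : Module (CoordRing k σ.1) (ChartSections E σ) :=
  Module.compHom Γ(E.sheaf, chartOpen k Δ σ) (coord k Δ σ)

instance : Module k (ChartSections E σ) :=
  Module.compHom (ChartSections E σ) (algebraMap k (CoordRing k σ.1))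

instance : IsScalarTower k (CoordRing k σ.1) (ChartSections E σ) :=
  IsScalarTower.of_algebraMap_smul fun _ _ => rfl

/-- The section `Φ(a^*s)` of `p^*E` on `T × U_σ`, where `a` is the action, `p` is the projection and
`Φ : a^*E ≅ p^*E` is the linearization. -/
def coaction : ChartSections E σ →+ Γ((Scheme.Modules.pullback
    (projMap (torus k n) (toricOver k Δ)).left).obj E.sheaf, prodOpen k Δ σ) :=
  (E.linearization.iso.hom.app (prodOpen k Δ σ)).hom.comp
    (pullSec (actMap (torus k n) (toricOver k Δ)).left E.sheaf (chartOpen k Δ σ) (prodOpen k Δ σ)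
      (prodOpen_le k Δ σ))

/-- The section `p^*s` of `p^*E` on `T × U_σ`, where `p` is the projection. -/
def trivialCoaction : ChartSections E σ →+ Γ((Scheme.Modules.pullback
    (projMap (torus k n) (toricOver k Δ)).left).obj E.sheaf, prodOpen k Δ σ) :=
  pullSec (projMap (torus k n) (toricOver k Δ)).left E.sheaf (chartOpen k Δ σ) (prodOpen k Δ σ)
    le_rfl

lemma coaction_smul (a : CoordRing k σ.1) (s : ChartSections E σ) :
    coaction E σ (a • s) = (actMap (torus k n) (toricOver k Δ)).left.appLE (chartOpen k Δ σ)
      (prodOpen k Δ σ) (prodOpen_le k Δ σ) (coord k Δ σ a) • coaction E σ s :=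
  (congrArg (E.linearization.iso.hom.app (prodOpen k Δ σ)) (pullSec_smul _ _ _ _ _ _ _)).trans
    (Scheme.Modules.Hom.app_smul _ _ _)

lemma trivialCoaction_smul (a : CoordRing k σ.1) (s : ChartSections E σ) :
    trivialCoaction E σ (a • s) = (projMap (torus k n) (toricOver k Δ)).left.appLE
      (chartOpen k Δ σ) (prodOpen k Δ σ) le_rfl (coord k Δ σ a) • trivialCoaction E σ s :=
  pullSec_smul _ _ _ _ _ _ _

/-- If `s` has degree `m`, then `c χ(d) s` has degree `m + d`. -/
lemma coaction_single_smul {m : Fin n → ℤ} (d : dualMonoid σ.1) (c : k) {s : ChartSections E σ}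
    (hs : coaction E σ s = charFun k Δ σ m • trivialCoaction E σ s) :
    coaction E σ ((AddMonoidAlgebra.single d c : CoordRing k σ.1) • s) =
      charFun k Δ σ (m + d) •
        trivialCoaction E σ ((AddMonoidAlgebra.single d c : CoordRing k σ.1) • s) := by
  rw [coaction_smul, trivialCoaction_smul, hs, act_coord, smul_smul, smul_smul, charFun_add]
  congr 1
  ring

/-- The isotypical component `E^σ_m` of `Γ(U_σ, E)` for the character `m`: the sections `s` with
`Φ(a^*s) = χ(m) p^*s`. -/
def weightSpace (m : Fin n → ℤ) : Submodule k (ChartSections E σ) where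
  carrier := {s | coaction E σ s = charFun k Δ σ m • trivialCoaction E σ s}
  zero_mem' := by
    change coaction E σ 0 = charFun k Δ σ m • trivialCoaction E σ 0
    rw [map_zero, map_zero, smul_zero]
  add_mem' {s t} hs ht := by
    change coaction E σ (s + t) = charFun k Δ σ m • trivialCoaction E σ (s + t)
    rw [map_add, map_add, smul_add]
    exact congrArg₂ _ hs ht
  smul_mem' c s hs := by
    have h := coaction_single_smul E σ 0 c hs
    rw [AddSubmonoid.coe_zero, add_zero] at h
    exact h

/-- Multiplication with `χ(m' - m)`, as a map `E^σ_m → E^σ_{m'}`. -/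
def weightMap {m m' : Fin n → ℤ} (h : LeCone σ.1 m m') :
    weightSpace E σ m →ₗ[k] weightSpace E σ m' where
  toFun s := ⟨(AddMonoidAlgebra.single ⟨m' - m, h⟩ 1 : CoordRing k σ.1) • s.1, by
    have h := coaction_single_smul E σ ⟨m' - m, h⟩ 1 s.2
    rwa [add_sub_cancel] at h⟩
  map_add' s t := Subtype.ext (smul_add _ s.1 t.1)
  map_smul' c s := Subtype.ext (smul_comm _ c s.1)

/-- The `σ`-family associated to an equivariant quasicoherent sheaf. -/
def associatedFamily : SigmaFamily k σ.1 where
  space m := weightSpace E σ m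
  map h := weightMap E σ h
  map_refl m := by
    ext s
    change (AddMonoidAlgebra.single ⟨m - m, _⟩ 1 : CoordRing k σ.1) • s.1 = s.1
    have : (⟨m - m, LeCone.refl σ.1 m⟩ : dualMonoid σ.1) = 0 := Subtype.ext (sub_self m)
    rw [this, ← AddMonoidAlgebra.one_def, one_smul]
  map_trans {m m' m''} h h' := by
    ext s
    change (AddMonoidAlgebra.single ⟨m'' - m, _⟩ 1 : CoordRing k σ.1) • s.1 =
      (AddMonoidAlgebra.single ⟨m'' - m', h'⟩ 1 : CoordRing k σ.1) •
        (AddMonoidAlgebra.single ⟨m' - m, h⟩ 1 : CoordRing k σ.1) • s.1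
    rw [smul_smul, AddMonoidAlgebra.single_mul_single, one_mul]
    congr 2
    exact Subtype.ext (sub_add_sub_cancel m'' m' m).symm

end Weights
end Toric

end

/-!
The sections of `E` on `U_σ` form a module `V` over `k[σ_M]`, and the linearization turns `V` into
a comodule under `k[M]`, i.e. into an `M`-graded module with homogeneous components `E^σ_m`. Once
this is known, the proposition is a statement on graded modules.

*Coherence.* Sections of a quasicoherent sheaf behave well under pullback: for `f : Y → Z` and
affine open subsets `V ⊆ f⁻¹(U)`, the module `Γ(V, f^*E)` is generated by the sections `f^*s` with
`s ∈ Γ(U, E)` (`span_range_pullSec`). For `f = id` this shows that finite generation passes to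
smaller affine open subsets; together with the local nature of finite generation on an affine
scheme it gives that `E` is coherent if and only if `Γ(U_σ, E)` is a finite `k[σ_M]`-module for
all `σ` (`isCoherent_iff_finite_chartSections`).

*Grading.* For `f` the projection `p : T × X → X`, the same fact allows one to write
`Φ(a^*s) = ∑ χ(m) p^*s_m`. Sections on `T × U_σ` are restricted to `{t} × U_σ` for the `k`-points
`t` of `T`. As `k` is infinite, distinct characters are distinct functions on `T(k)`, so by
Dedekind's theorem they are linearly independent; thus components of different degrees are
independent (`eq_zero_of_sum_weightSpace`). The cocycle condition, restricted to the points
`(t, t')` of `T × T`, becomes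
`∑ χ(m)(t) χ(m)(t') s_m = ∑ χ(m)(t) χ(m')(t') s_{m,m'}`
with `Φ(a^*s_m) = ∑ χ(m') p^*s_{m,m'}`, and independence of characters yields `s_m ∈ E^σ_m`
(`mem_weightSpace_of_coaction_eq`). Finally, by the same fact for `f` the action `a`, the section
`p^*s` is a combination of sections `Φ(a^*s')`, and restriction to `{1} × U_σ` writes `s` as a
combination of homogeneous sections (`span_weightSpace`).

*Graded modules.* If `V` is finite, choose homogeneous generators `g`; then `E^σ_m` is spanned by
the `χ(m - deg g) g`, which gives the three finiteness conditions (`isFinite_associatedFamily`).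
The condition on chains uses a height function, the sum of the pairings with generators of `σ`,
which is strictly increasing along chains. Conversely, let `N` be generated by the `E^σ_m` for `m`
in a finite set of representatives of the classes in which `E^σ_m` is not generated by smaller
components. If some `E^σ_m` were not contained in `N`, then one would find a smaller one with the
same property, and so on; the resulting descending sequence extends to a chain indexed by `ℤ`,
contrary to the condition on chains (`finite_of_isFinite_associatedFamily`).
-/

noncomputable section

/-! ### Pullback of sections -/

namespace Toric

section PullSec

variable {W Y Z : Scheme.{u}}

/-- The pullback `f^*s` of a section `s` of `E` on `U`, as a section of `f^*E` on `f⁻¹(U)`. -/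
def unitSec (f : Y ⟶ Z) (E : Z.Modules) (U : Z.Opens) :
    Γ(E, U) →+ Γ((Scheme.Modules.pullback f).obj E, f ⁻¹ᵁ U) :=
  (((Scheme.Modules.pullbackPushforwardAdjunction f).unit.app E).app U).hom

lemma pullSec_apply (f : Y ⟶ Z) (E : Z.Modules) (U : Z.Opens) (V : Y.Opens)
    (h : V ≤ f ⁻¹ᵁ U) (s : Γ(E, U)) :
    pullSec f E U V h s = ((Scheme.Modules.pullback f).obj E).presheaf.map (homOfLE h).op
      (unitSec f E U s) := rfl

lemma app_map_apply {X : Scheme.{u}} {M N : X.Modules} (φ : M ⟶ N) {U V : X.Opens} (h : V ≤ U)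
    (s : Γ(M, U)) : φ.app V (M.presheaf.map (homOfLE h).op s) =
      N.presheaf.map (homOfLE h).op (φ.app U s) :=
  ConcreteCategory.congr_hom (φ.mapPresheaf.naturality (homOfLE h).op) s

lemma presheaf_map_map {X : Scheme.{u}} (M : X.Modules) {U V V' : X.Opens} (h : V ≤ U)
    (h' : V' ≤ V) (s : Γ(M, U)) :
    M.presheaf.map (homOfLE h').op (M.presheaf.map (homOfLE h).op s) =
      M.presheaf.map (homOfLE (h'.trans h)).op s :=
  (ConcreteCategory.congr_hom (M.presheaf.map_comp (homOfLE h).op (homOfLE h').op) s).symm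

lemma pullSec_map (f : Y ⟶ Z) (E : Z.Modules) {U U' : Z.Opens} {V : Y.Opens}
    (h' : U' ≤ U) (h : V ≤ f ⁻¹ᵁ U') (s : Γ(E, U)) :
    pullSec f E U' V h (E.presheaf.map (homOfLE h').op s) =
      pullSec f E U V (h.trans (f.preimage_mono h')) s := by
  have e : unitSec f E U' (E.presheaf.map (homOfLE h').op s) =
      ((Scheme.Modules.pullback f).obj E).presheaf.map (homOfLE (f.preimage_mono h')).op
        (unitSec f E U s) :=
    app_map_apply ((Scheme.Modules.pullbackPushforwardAdjunction f).unit.app E) h' s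
  rw [pullSec_apply, e]
  exact presheaf_map_map _ (f.preimage_mono h') h _

/-- The pullback of sections is natural in the sheaf. -/
lemma pullback_map_pullSec (f : Y ⟶ Z) {E E' : Z.Modules} (ψ : E ⟶ E') {U : Z.Opens} {V : Y.Opens}
    (h : V ≤ f ⁻¹ᵁ U) (s : Γ(E, U)) :
    ((Scheme.Modules.pullback f).map ψ).app V (pullSec f E U V h s) =
      pullSec f E' U V h (ψ.app U s) := by
  rw [pullSec_apply, pullSec_apply, app_map_apply]
  congr 1
  exact (ConcreteCategory.congr_hom (congrArg (fun q => Scheme.Modules.Hom.app q U)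
    ((Scheme.Modules.pullbackPushforwardAdjunction f).unit.naturality ψ)) s).symm

/-- Pulling back a section in two steps. -/
lemma pullbackComp_hom_pullSec (h : W ⟶ Y) (f : Y ⟶ Z) (E : Z.Modules) {U : Z.Opens} {V : Y.Opens}
    {V' : W.Opens} (hV : V ≤ f ⁻¹ᵁ U) (hV' : V' ≤ h ⁻¹ᵁ V) (hV'' : V' ≤ (h ≫ f) ⁻¹ᵁ U)
    (s : Γ(E, U)) :
    ((Scheme.Modules.pullbackComp h f).hom.app E).app V'
      (pullSec h ((Scheme.Modules.pullback f).obj E) V V' hV' (pullSec f E U V hV s)) =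
    pullSec (h ≫ f) E U V' hV'' s := by
  have key := unit_conjugateEquiv
    ((Scheme.Modules.pullbackPushforwardAdjunction f).comp
      (Scheme.Modules.pullbackPushforwardAdjunction h))
    (Scheme.Modules.pullbackPushforwardAdjunction (h ≫ f))
    (Scheme.Modules.pullbackComp h f).inv E
  rw [Scheme.Modules.conjugateEquiv_pullbackComp_inv] at key
  have key2 := ConcreteCategory.congr_hom (congrArg (fun q => Scheme.Modules.Hom.app q U) key) s
  rw [pullSec_apply f, pullSec_map]
  have e : ((Scheme.Modules.pullbackComp h f).hom.app E).app (h ⁻¹ᵁ f ⁻¹ᵁ U)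
      (unitSec h ((Scheme.Modules.pullback f).obj E) (f ⁻¹ᵁ U) (unitSec f E U s)) =
      unitSec (h ≫ f) E U s := by
    have e1 : unitSec h ((Scheme.Modules.pullback f).obj E) (f ⁻¹ᵁ U) (unitSec f E U s) =
        ((Scheme.Modules.pullbackComp h f).inv.app E).app (h ⁻¹ᵁ f ⁻¹ᵁ U)
        (unitSec (h ≫ f) E U s) := by
      refine Eq.trans ?_ key2
      rw [Adjunction.comp_unit_app]
      rfl
    rw [e1]
    exact ConcreteCategory.congr_hom (congrArg (fun q => Scheme.Modules.Hom.app q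
      (h ⁻¹ᵁ f ⁻¹ᵁ U)) ((Scheme.Modules.pullbackComp h f).inv_hom_id_app E)) _
  refine (app_map_apply ((Scheme.Modules.pullbackComp h f).hom.app E)
    (U := h ⁻¹ᵁ f ⁻¹ᵁ U) (V := V') hV'' _).trans ?_
  exact congrArg (((Scheme.Modules.pullback (h ≫ f)).obj E).presheaf.map (homOfLE hV'').op) e

lemma pullbackComp_inv_pullSec (h : W ⟶ Y) (f : Y ⟶ Z) (E : Z.Modules) {U : Z.Opens} {V : Y.Opens}
    {V' : W.Opens} (hV : V ≤ f ⁻¹ᵁ U) (hV' : V' ≤ h ⁻¹ᵁ V) (hV'' : V' ≤ (h ≫ f) ⁻¹ᵁ U)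
    (s : Γ(E, U)) :
    ((Scheme.Modules.pullbackComp h f).inv.app E).app V' (pullSec (h ≫ f) E U V' hV'' s) =
      pullSec h ((Scheme.Modules.pullback f).obj E) V V' hV' (pullSec f E U V hV s) := by
  rw [← pullbackComp_hom_pullSec h f E hV hV' hV'' s]
  exact ConcreteCategory.congr_hom (congrArg (fun q => Scheme.Modules.Hom.app q V')
    ((Scheme.Modules.pullbackComp h f).hom_inv_id_app E)) _

lemma pullbackCongr_hom_pullSec {f g : Y ⟶ Z} (e : f = g) (E : Z.Modules) {U : Z.Opens}
    {V : Y.Opens} (h : V ≤ f ⁻¹ᵁ U) (h' : V ≤ g ⁻¹ᵁ U) (s : Γ(E, U)) :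
    ((Scheme.Modules.pullbackCongr e).hom.app E).app V (pullSec f E U V h s) =
      pullSec g E U V h' s := by
  subst e
  rfl

lemma pullbackId_hom_pullSec (E : Z.Modules) {U : Z.Opens} {V : Z.Opens}
    (h : V ≤ (𝟙 Z) ⁻¹ᵁ U) (s : Γ(E, U)) :
    ((Scheme.Modules.pullbackId Z).hom.app E).app V (pullSec (𝟙 Z) E U V h s) =
      E.presheaf.map (homOfLE h).op s := by
  have key := unit_conjugateEquiv .id (Scheme.Modules.pullbackPushforwardAdjunction (𝟙 Z))
    (Scheme.Modules.pullbackId Z).hom E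
  rw [Scheme.Modules.conjugateEquiv_pullbackId_hom] at key
  have key2 := ConcreteCategory.congr_hom (congrArg (fun q => Scheme.Modules.Hom.app q U) key) s
  rw [pullSec_apply, app_map_apply]
  congr 1
  exact key2.symm

/-- The identification of `i^*f^*E` with `E` for a section `i` of `f`. -/
def sectionPullIso (i : Z ⟶ Y) (f : Y ⟶ Z) (hi : i ≫ f = 𝟙 Z) (E : Z.Modules) :
    (Scheme.Modules.pullback i).obj ((Scheme.Modules.pullback f).obj E) ⟶ E :=
  (Scheme.Modules.pullbackComp i f).hom.app E ≫ (Scheme.Modules.pullbackCongr hi).hom.app E ≫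
    (Scheme.Modules.pullbackId Z).hom.app E

/-- The pullback of a section along a section `i` of a morphism `f`. -/
def sectionPull (i : Z ⟶ Y) (f : Y ⟶ Z) (hi : i ≫ f = 𝟙 Z) (E : Z.Modules) (U : Z.Opens)
    (V : Y.Opens) (h : U ≤ i ⁻¹ᵁ V) : Γ((Scheme.Modules.pullback f).obj E, V) →+ Γ(E, U) :=
  ((sectionPullIso i f hi E).app U).hom.comp (pullSec i ((Scheme.Modules.pullback f).obj E) V U h)

lemma sectionPull_smul (i : Z ⟶ Y) (f : Y ⟶ Z) (hi : i ≫ f = 𝟙 Z) (E : Z.Modules) (U : Z.Opens)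
    (V : Y.Opens) (h : U ≤ i ⁻¹ᵁ V) (r : Γ(Y, V)) (s : Γ((Scheme.Modules.pullback f).obj E, V)) :
    sectionPull i f hi E U V h (r • s) = i.appLE V U h r • sectionPull i f hi E U V h s :=
  (congrArg ((sectionPullIso i f hi E).app U) (pullSec_smul i _ V U h r s)).trans
    (Scheme.Modules.Hom.app_smul (sectionPullIso i f hi E) _ _)

lemma sectionPull_pullSec (i : Z ⟶ Y) (f : Y ⟶ Z) (hi : i ≫ f = 𝟙 Z) (E : Z.Modules) (U : Z.Opens)
    (V : Y.Opens) (h : U ≤ i ⁻¹ᵁ V) (hV : V ≤ f ⁻¹ᵁ U) (s : Γ(E, U)) :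
    sectionPull i f hi E U V h (pullSec f E U V hV s) = s := by
  have h1 : U ≤ (i ≫ f) ⁻¹ᵁ U := by rw [hi]; exact le_rfl
  have h2 : U ≤ (𝟙 Z) ⁻¹ᵁ U := le_rfl
  refine (congrArg (fun x => ((Scheme.Modules.pullbackId Z).hom.app E).app U
    (((Scheme.Modules.pullbackCongr hi).hom.app E).app U x))
    (pullbackComp_hom_pullSec i f E hV h h1 s)).trans ?_
  refine (congrArg (fun x => ((Scheme.Modules.pullbackId Z).hom.app E).app U x)
    (pullbackCongr_hom_pullSec hi E h1 h2 s)).trans ?_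
  refine (pullbackId_hom_pullSec E h2 s).trans ?_
  exact ConcreteCategory.congr_hom (E.presheaf.map_id _) s

/-- If `φ : f^*E → g^*E` sends `f^*s` to `∑ rᵢ g^*sᵢ`, then `h^*φ` sends `(f ∘ h)^*s` to
`∑ h^*(rᵢ) (g ∘ h)^*sᵢ`. -/
lemma pullHom_pullSec (h : W ⟶ Y) {f g : Y ⟶ Z} {E : Z.Modules}
    (φ : (Scheme.Modules.pullback f).obj E ⟶ (Scheme.Modules.pullback g).obj E)
    {U : Z.Opens} {V : Y.Opens} {V' : W.Opens} (hf : V ≤ f ⁻¹ᵁ U) (hg : V ≤ g ⁻¹ᵁ U)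
    (hV' : V' ≤ h ⁻¹ᵁ V) (hf' : V' ≤ (h ≫ f) ⁻¹ᵁ U) (hg' : V' ≤ (h ≫ g) ⁻¹ᵁ U)
    {ι : Type*} (I : Finset ι) (r : ι → Γ(Y, V)) (t : ι → Γ(E, U)) (s : Γ(E, U))
    (hs : φ.app V (pullSec f E U V hf s) = ∑ i ∈ I, r i • pullSec g E U V hg (t i)) :
    (pullHom h φ).app V' (pullSec (h ≫ f) E U V' hf' s) =
      ∑ i ∈ I, h.appLE V V' hV' (r i) • pullSec (h ≫ g) E U V' hg' (t i) := by
  change ((Scheme.Modules.pullbackComp h g).hom.app E).app V'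
    (((Scheme.Modules.pullback h).map φ).app V'
      (((Scheme.Modules.pullbackComp h f).inv.app E).app V' (pullSec (h ≫ f) E U V' hf' s))) = _
  rw [pullbackComp_inv_pullSec h f E hf hV' hf', pullback_map_pullSec, hs, map_sum, map_sum]
  refine Finset.sum_congr rfl fun i _ => ?_
  rw [pullSec_smul, Scheme.Modules.Hom.app_smul, pullbackComp_hom_pullSec h g E hg hV' hg']

end PullSec

end Toric

/-! ### Generation of pullbacks: morphisms of affine schemes -/

namespace Toric

section Generation

open scoped ChangeOfRings

variable {R S : CommRingCat.{u}} (φ : R ⟶ S)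

/-- Taking global sections commutes with the pushforward along a morphism of affine schemes. -/
def pushforwardΓIso : Scheme.Modules.pushforward (Spec.map φ) ⋙ moduleSpecΓFunctor (R := R) ≅
    moduleSpecΓFunctor (R := S) ⋙ ModuleCat.restrictScalars φ.hom :=
  Functor.isoWhiskerRight (pushforwardCompModulesSpecToSheafIso φ)
    (TopCat.Sheaf.forget _ _ ⋙ (evaluation _ _).obj (.op ⊤))

/-- The pullback of the sheaf `M^~` to `Spec S` is the sheaf associated with `S ⊗ M`: both are left
adjoint to taking global sections of the pushforward to `Spec R`. -/
def tildePullbackIso : ModuleCat.extendScalars φ.hom ⋙ tilde.functor S ≅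
    tilde.functor R ⋙ Scheme.Modules.pullback (Spec.map φ) :=
  (conjugateIsoEquiv (tilde.adjunction.comp
      (Scheme.Modules.pullbackPushforwardAdjunction (Spec.map φ)))
    ((ModuleCat.extendRestrictScalarsAdj φ.hom).comp tilde.adjunction)).symm (pushforwardΓIso φ)

/-- The identification of a module `M` with the global sections of `M^~`. -/
def tildeGlobal (M : ModuleCat.{u} R) : M →+ Γ(tilde M, ⊤) :=
  (tilde.toOpen M ⊤).hom.toAddMonoidHom

lemma tildeGlobal_surjective (M : ModuleCat.{u} R) : Function.Surjective (tildeGlobal M) :=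
  ((ConcreteCategory.isIso_iff_bijective (tilde.toOpen M ⊤)).1 inferInstance).2

lemma tildeGlobal_smul (M : ModuleCat.{u} R) (r : R) (m : M) :
    tildeGlobal M (r • m) = (Scheme.ΓSpecIso R).inv r • tildeGlobal M m := by
  refine ((tilde.toOpen M ⊤).hom.map_smul r m).trans ?_
  refine (Scheme.Modules.smul_Spec_def (M := tilde M) (U := ⊤) r (tildeGlobal M m)).trans ?_
  exact congrArg (· • tildeGlobal M m) (ConcreteCategory.congr_hom ((Spec R).presheaf.map_id _) _)

/-- The map from `S ⊗ M` to the global sections of the pullback of `M^~` to `Spec S`. -/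
def tensorGlobal (M : ModuleCat.{u} R) : (ModuleCat.extendScalars φ.hom).obj M →+
    Γ((Scheme.Modules.pullback (Spec.map φ)).obj (tilde M), ⊤) :=
  (((tildePullbackIso φ).hom.app M).app ⊤).hom.comp
    (tildeGlobal ((ModuleCat.extendScalars φ.hom).obj M))

lemma tensorGlobal_surjective (M : ModuleCat.{u} R) : Function.Surjective (tensorGlobal φ M) :=
  (((ConcreteCategory.isIso_iff_bijective
    (((tildePullbackIso φ).hom.app M).app ⊤)).1 inferInstance).2).comp (tildeGlobal_surjective _)

lemma tensorGlobal_smul (M : ModuleCat.{u} R) (r : S)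
    (z : (ModuleCat.extendScalars φ.hom).obj M) :
    tensorGlobal φ M (r • z) = (Scheme.ΓSpecIso S).inv r • tensorGlobal φ M z :=
  (congrArg (((tildePullbackIso φ).hom.app M).app ⊤) (tildeGlobal_smul _ r z)).trans
    (Scheme.Modules.Hom.app_smul _ _ _)

/-- The map `m ↦ 1 ⊗ m` from `M` to `S ⊗ M`. -/
def tensorOne (M : ModuleCat.{u} R) (m : M) : (ModuleCat.extendScalars φ.hom).obj M :=
  (ModuleCat.extendRestrictScalarsAdj φ.hom).unit.app M m

/-- The section given by `1 ⊗ m` is the pullback of the section given by `m`. -/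
lemma tensorGlobal_unit (M : ModuleCat.{u} R) (m : M) (h : ⊤ ≤ (Spec.map φ) ⁻¹ᵁ ⊤) :
    tensorGlobal φ M (tensorOne φ M m) =
      pullSec (Spec.map φ) (tilde M) ⊤ ⊤ h (tildeGlobal M m) := by
  have key := unit_conjugateEquiv_symm (tilde.adjunction.comp
      (Scheme.Modules.pullbackPushforwardAdjunction (Spec.map φ)))
    ((ModuleCat.extendRestrictScalarsAdj φ.hom).comp tilde.adjunction) (pushforwardΓIso φ).hom M
  have e : pullSec (Spec.map φ) (tilde M) ⊤ ⊤ h (tildeGlobal M m) =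
      unitSec (Spec.map φ) (tilde M) ⊤ (tildeGlobal M m) :=
    ConcreteCategory.congr_hom (((Scheme.Modules.pullback (Spec.map φ)).obj
      (tilde M)).presheaf.map_id _) _
  rw [e]
  exact (ConcreteCategory.congr_hom key m).symm

lemma smul_tensorOne (M : ModuleCat.{u} R) (r : S) (m : M) :
    r • tensorOne φ M m = r ⊗ₜ[R,φ.hom] m :=
  congrArg (fun x : S => x ⊗ₜ[R,φ.hom] m) (mul_one r)

lemma extendScalars_mem_span (M : ModuleCat.{u} R) (z : (ModuleCat.extendScalars φ.hom).obj M) :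
    z ∈ Submodule.span S (Set.range (tensorOne φ M)) := by
  induction z using TensorProduct.induction_on with
  | zero => exact zero_mem (Submodule.span S (Set.range (tensorOne φ M)))
  | add a b ha hb => exact add_mem (S := Submodule S ((ModuleCat.extendScalars φ.hom).obj M)) ha hb
  | tmul r m =>
    refine (congrArg (· ∈ Submodule.span S (Set.range (tensorOne φ M)))
      (smul_tensorOne φ M r m)).mp ?_
    exact Submodule.smul_mem _ _ (Submodule.subset_span ⟨m, rfl⟩)

lemma span_range_pullSec_tilde (M : ModuleCat.{u} R) (h : ⊤ ≤ (Spec.map φ) ⁻¹ᵁ ⊤) :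
    Submodule.span Γ(Spec S, ⊤)
      (Set.range (pullSec (Spec.map φ) (tilde M) ⊤ ⊤ h)) = ⊤ := by
  rw [eq_top_iff]
  rintro y -
  obtain ⟨z, rfl⟩ := tensorGlobal_surjective φ M y
  have hz := extendScalars_mem_span φ M z
  induction hz using Submodule.span_induction with
  | zero => rw [map_zero]; exact zero_mem _
  | add a b _ _ ha hb => rw [map_add]; exact add_mem ha hb
  | smul r a _ ha => rw [tensorGlobal_smul]; exact Submodule.smul_mem _ _ ha
  | mem x hx =>
    obtain ⟨m, rfl⟩ := hx
    exact Submodule.subset_span ⟨_, (tensorGlobal_unit φ M m h).symm⟩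

/-- For a quasicoherent sheaf `F` on `Spec R`, the global sections of its pullback to `Spec S` are
generated by the pullbacks of global sections, since `F` is of the form `M^~`. -/
lemma span_range_pullSec_spec (F : (Spec R).Modules) [F.IsQuasicoherent]
    (h : ⊤ ≤ (Spec.map φ) ⁻¹ᵁ ⊤) :
    Submodule.span Γ(Spec S, ⊤) (Set.range (pullSec (Spec.map φ) F ⊤ ⊤ h)) = ⊤ := by
  let M := (modulesSpecToSheaf.obj F).presheaf.obj (.op ⊤)
  let ψ : tilde M ⟶ F := F.fromTildeΓ
  let β := (Scheme.Modules.pullback (Spec.map φ)).map ψ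
  have : IsIso ψ := inferInstanceAs (IsIso F.fromTildeΓ)
  have : IsIso β := inferInstanceAs (IsIso ((Scheme.Modules.pullback (Spec.map φ)).map ψ))
  rw [eq_top_iff]
  rintro y -
  obtain ⟨w, rfl⟩ : ∃ w, β.app ⊤ w = y :=
    ((ConcreteCategory.isIso_iff_bijective (β.app ⊤)).1 inferInstance).2 y
  have hw : w ∈ Submodule.span Γ(Spec S, ⊤)
      (Set.range (pullSec (Spec.map φ) (tilde M) ⊤ ⊤ h)) := by
    rw [span_range_pullSec_tilde]; trivial
  induction hw using Submodule.span_induction with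
  | zero => rw [map_zero]; exact zero_mem _
  | add a b _ _ ha hb => rw [map_add]; exact add_mem ha hb
  | smul r a _ ha => rw [Scheme.Modules.Hom.app_smul]; exact Submodule.smul_mem _ _ ha
  | mem x hx =>
    obtain ⟨s, rfl⟩ := hx
    refine Submodule.subset_span ⟨ψ.app ⊤ s, ?_⟩
    exact (pullback_map_pullSec (Spec.map φ) ψ h s).symm

end Generation

end Toric

/-! ### Generation of pullbacks: affine open subsets -/

namespace Toric

section GenerationAffineOpen

variable {W Y Z : Scheme.{u}}

lemma isQuasicoherent_pullback_of_isOpenImmersion (c : W ⟶ Z) [IsOpenImmersion c] (E : Z.Modules)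
    [E.IsQuasicoherent] : ((Scheme.Modules.pullback c).obj E).IsQuasicoherent :=
  (SheafOfModules.isQuasicoherent W.ringCatSheaf).prop_of_iso
    ((Scheme.Modules.restrictFunctorIsoPullback c).app E)
    (Scheme.Modules.isQuasicoherent_restrictFunctor c E)

lemma bijective_map_of_eq {X : Scheme.{u}} (E : X.Modules) {U V : X.Opens} (h : V ≤ U)
    (e : V = U) : Function.Bijective (E.presheaf.map (homOfLE h).op) := by
  subst e
  have : E.presheaf.map (homOfLE h).op = 𝟙 _ := E.presheaf.map_id _
  rw [this]
  exact Function.bijective_id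

/-- Along an open immersion, the pullback of sections is restriction. -/
lemma pullSec_bijective (c : W ⟶ Z) [IsOpenImmersion c] (E : Z.Modules) (U : Z.Opens)
    (V : W.Opens) (h : V ≤ c ⁻¹ᵁ U) (e : c ''ᵁ V = U) : Function.Bijective (pullSec c E U V h) := by
  let ψ := (Scheme.Modules.restrictFunctorIsoPullback c).hom.app E
  have key := Adjunction.unit_leftAdjointUniq_hom_app (Scheme.Modules.restrictAdjunction c)
    (Scheme.Modules.pullbackPushforwardAdjunction c) E
  have e1 : ∀ s, pullSec c E U V h s =
      ψ.app V (E.presheaf.map (homOfLE (e.le : c ''ᵁ V ≤ U)).op s) := by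
    intro s
    have e2 : unitSec c E U s =
        ψ.app (c ⁻¹ᵁ U) (E.presheaf.map (homOfLE (c.image_preimage_le U)).op s) :=
      (ConcreteCategory.congr_hom (congrArg (fun q => Scheme.Modules.Hom.app q U) key) s).symm
    rw [pullSec_apply, e2]
    refine (app_map_apply ψ h _).symm.trans ?_
    congr 1
    exact presheaf_map_map E (c.image_preimage_le U) (c.image_mono h) s
  have e3 : Function.Bijective (ψ.app V) :=
    (ConcreteCategory.isIso_iff_bijective (ψ.app V)).1 inferInstance
  have e4 := e3.comp (bijective_map_of_eq E e.le e)
  convert e4 using 1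
  funext s
  exact e1 s

lemma appLE_bijective (j : W ⟶ Y) [IsOpenImmersion j] (V : Y.Opens) (hj : ⊤ ≤ j ⁻¹ᵁ V)
    (hV : V ≤ j.opensRange) : Function.Bijective (j.appLE V ⊤ hj) := by
  have h1 : j ⁻¹ᵁ V = ⊤ := top_le_iff.1 hj
  have : IsIso (j.app V) := Scheme.Hom.isIso_app j _ hV
  have : IsIso (j.appLE V ⊤ hj) := by
    have h2 : IsIso (homOfLE hj).op := by
      have : IsIso (homOfLE hj) := ⟨homOfLE h1.le, Subsingleton.elim _ _, Subsingleton.elim _ _⟩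
      infer_instance
    rw [Scheme.Hom.appLE]
    infer_instance
  exact (ConcreteCategory.isIso_iff_bijective _).1 this

/-- For a quasicoherent sheaf `E`, the sections of `f^*E` on an affine open subset `V` are
generated by the pullbacks of the sections of `E` on an affine open subset `U ⊇ f(V)`. -/
theorem span_range_pullSec (f : Y ⟶ Z) (E : Z.Modules) [E.IsQuasicoherent] {U : Z.Opens}
    {V : Y.Opens} (hU : IsAffineOpen U) (hV : IsAffineOpen V) (h : V ≤ f ⁻¹ᵁ U) :
    Submodule.span Γ(Y, V) (Set.range (pullSec f E U V h)) = ⊤ := by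
  let c := hU.fromSpec
  let d := hV.fromSpec
  let g := Spec.map (f.appLE U V h)
  have hgc : g ≫ c = d ≫ f := hU.SpecMap_appLE_fromSpec f hV h
  -- `Θ` identifies `d^*f^*E` with `g^*c^*E`, where `c : Spec Γ(Z, U) → Z`, `d : Spec Γ(Y, V) → Y`
  let Θ := (Scheme.Modules.pullbackComp d f).hom.app E ≫
    (Scheme.Modules.pullbackCongr hgc.symm).hom.app E ≫ (Scheme.Modules.pullbackComp g c).inv.app E
  have hdV : d.opensRange = V := hV.opensRange_fromSpec
  have hcU : c.opensRange = U := hU.opensRange_fromSpec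
  have hd : ⊤ ≤ d ⁻¹ᵁ V := fun x _ => hdV.le ⟨x, rfl⟩
  have hc : ⊤ ≤ c ⁻¹ᵁ U := fun x _ => hcU.le ⟨x, rfl⟩
  have hg : ⊤ ≤ g ⁻¹ᵁ ⊤ := le_top
  have hdf : ⊤ ≤ (d ≫ f) ⁻¹ᵁ U := fun x hx => h (hd hx)
  have hgc' : ⊤ ≤ (g ≫ c) ⁻¹ᵁ U := by rw [hgc]; exact hdf
  have hcomp : ∀ s, Θ.app ⊤ (pullSec d _ V ⊤ hd (pullSec f E U V h s)) =
      pullSec g _ ⊤ ⊤ hg (pullSec c E U ⊤ hc s) := by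
    intro s
    refine (congrArg (fun x => ((Scheme.Modules.pullbackComp g c).inv.app E).app ⊤
      (((Scheme.Modules.pullbackCongr hgc.symm).hom.app E).app ⊤ x))
      (pullbackComp_hom_pullSec d f E h hd hdf s)).trans ?_
    refine (congrArg (fun x => ((Scheme.Modules.pullbackComp g c).inv.app E).app ⊤ x)
      (pullbackCongr_hom_pullSec hgc.symm E hdf hgc' s)).trans ?_
    exact pullbackComp_inv_pullSec g c E hc hg hgc' s
  have hinj : Function.Injective fun y => Θ.app ⊤ (pullSec d _ V ⊤ hd y) := by
    have : IsIso Θ := inferInstance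
    exact ((ConcreteCategory.isIso_iff_bijective (Θ.app ⊤)).1 inferInstance).1.comp
      (pullSec_bijective d _ V ⊤ hd (by rw [Scheme.Hom.image_top_eq_opensRange, hdV])).1
  have hqc := isQuasicoherent_pullback_of_isOpenImmersion c E
  have key : ∀ w, ∃ y ∈ Submodule.span Γ(Y, V) (Set.range (pullSec f E U V h)),
      Θ.app ⊤ (pullSec d _ V ⊤ hd y) = w := by
    intro w
    have hw : w ∈ Submodule.span Γ(Spec Γ(Y, V), ⊤) (Set.range (pullSec g
        ((Scheme.Modules.pullback c).obj E) ⊤ ⊤ hg)) := by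
      rw [span_range_pullSec_spec]; trivial
    induction hw using Submodule.span_induction with
    | zero => exact ⟨0, zero_mem _, by rw [map_zero, map_zero]⟩
    | add a b _ _ ha hb =>
      obtain ⟨a', ha', rfl⟩ := ha
      obtain ⟨b', hb', rfl⟩ := hb
      exact ⟨a' + b', add_mem ha' hb', by rw [map_add, map_add]⟩
    | smul r a _ ha =>
      obtain ⟨a', ha', rfl⟩ := ha
      obtain ⟨r', rfl⟩ := (appLE_bijective d V hd hdV.ge).2 r
      exact ⟨r' • a', Submodule.smul_mem _ _ ha',
        by rw [pullSec_smul, Scheme.Modules.Hom.app_smul]⟩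
    | mem x hx =>
      obtain ⟨s', rfl⟩ := hx
      obtain ⟨s, rfl⟩ := (pullSec_bijective c E U ⊤ hc
        (by rw [Scheme.Hom.image_top_eq_opensRange, hcU])).2 s'
      exact ⟨_, Submodule.subset_span ⟨s, rfl⟩, hcomp s⟩
  rw [eq_top_iff]
  rintro y -
  obtain ⟨y', hy', e⟩ := key (Θ.app ⊤ (pullSec d _ V ⊤ hd y))
  rw [← hinj e]
  exact hy'

end GenerationAffineOpen

end Toric

/-! ### Finitely generated modules of sections -/

namespace Toric

section FiniteSections

/-- If the image of an additive map, semilinear along a map of sets `φ`, generates the target, then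
finiteness passes from the source to the target. -/
lemma finite_of_semilinear_surjective {A B M N : Type*} [CommRing A] [CommRing B] [AddCommGroup M]
    [AddCommGroup N] [Module A M] [Module B N] (φ : A → B) (e : M →+ N)
    (he : Submodule.span B (Set.range e) = ⊤) (h : ∀ a m, e (a • m) = φ a • e m)
    [hM : Module.Finite A M] : Module.Finite B N := by
  classical
  obtain ⟨s, hs⟩ := hM.1
  refine ⟨⟨s.image e, ?_⟩⟩
  rw [eq_top_iff, ← he, Submodule.span_le]
  rintro _ ⟨m, rfl⟩
  have hm : m ∈ Submodule.span A (s : Set M) := by rw [hs]; trivial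
  induction hm using Submodule.span_induction with
  | zero => rw [map_zero]; exact zero_mem _
  | add a b _ _ ha hb => rw [map_add]; exact add_mem ha hb
  | smul r a _ ha => rw [h]; exact Submodule.smul_mem _ _ ha
  | mem x hx => exact Submodule.subset_span (by simpa using ⟨x, hx, rfl⟩)

lemma finite_of_semilinear_bijective {A B M N : Type*} [CommRing A] [CommRing B] [AddCommGroup M]
    [AddCommGroup N] [Module A M] [Module B N] (φ : A → B) (hφ : Function.Surjective φ)
    (e : M →+ N) (he : Function.Bijective e) (h : ∀ a m, e (a • m) = φ a • e m)
    [hN : Module.Finite B N] : Module.Finite A M := by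
  let e' := (AddEquiv.ofBijective e he).symm
  obtain ⟨ψ, hψ⟩ := hφ.hasRightInverse
  have he' : ∀ n, e (e' n) = n := (AddEquiv.ofBijective e he).apply_symm_apply
  refine finite_of_semilinear_surjective (A := B) ψ e'.toAddMonoidHom ?_ fun b n => ?_
  · have : Set.range e'.toAddMonoidHom = Set.univ := Set.range_eq_univ.2 e'.surjective
    rw [this, Submodule.span_univ]
  · apply he.1
    change e (e' (b • n)) = e (ψ b • e' n)
    rw [he', h, hψ, he']

variable {X : Scheme.{u}} (E : X.Modules) [E.IsQuasicoherent]

/-- Finite generation of sections passes to smaller affine open subsets, because the sections on `V`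
are generated by restrictions of sections on `U`. -/
lemma finite_sections_of_le {U V : X.Opens} (hU : IsAffineOpen U) (hV : IsAffineOpen V)
    (h : V ≤ U) [Module.Finite Γ(X, U) Γ(E, U)] : Module.Finite Γ(X, V) Γ(E, V) := by
  have h' : V ≤ (𝟙 X) ⁻¹ᵁ U := h
  let ψ := (Scheme.Modules.pullbackId X).hom.app E
  have hψ : Function.Surjective (ψ.app V) :=
    ((ConcreteCategory.isIso_iff_bijective (ψ.app V)).1 inferInstance).2
  have h1 : Module.Finite Γ(X, V) Γ((Scheme.Modules.pullback (𝟙 X)).obj E, V) :=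
    finite_of_semilinear_surjective _ (pullSec (𝟙 X) E U V h') (span_range_pullSec _ E hU hV h')
      (pullSec_smul _ _ _ _ _)
  refine finite_of_semilinear_surjective id (ψ.app V).hom ?_ (Scheme.Modules.Hom.app_smul ψ)
  rw [Set.range_eq_univ.2 hψ, Submodule.span_univ]

/-- The principal open subset `D(f)` of `Spec R`. -/
def specOpen {R : CommRingCat.{u}} (f : R) : (Spec R).Opens := PrimeSpectrum.basicOpen f

/-- Finite generation of the global sections of a quasicoherent sheaf on `Spec R` may be tested on
principal open subsets, where sections are localizations. -/
lemma finite_of_finite_specOpen {R : CommRingCat.{u}} (M : (Spec R).Modules) [M.IsQuasicoherent]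
    (h : ∀ y : Spec R, ∃ f : R, y ∈ specOpen f ∧
      Module.Finite Γ(Spec R, specOpen f) Γ(M, specOpen f)) :
    Module.Finite R Γ(M, ⊤) := by
  have hloc := (isIso_fromTildeΓ_iff_isLocalizing M).1 inferInstance
  let s : Set R := {f | Module.Finite Γ(Spec R, specOpen f) Γ(M, specOpen f)}
  have hs : Ideal.span s = ⊤ := by
    by_contra hne
    obtain ⟨m, hm, hle⟩ := Ideal.exists_le_maximal _ hne
    obtain ⟨f, hf, hfin⟩ := h ⟨m, hm.isPrime⟩
    exact hf (hle (Ideal.subset_span hfin))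
  let ρ (f : s) : Γ(M, ⊤) →ₗ[R] Γ(M, specOpen f.1) :=
    ((modulesSpecToSheaf.obj M).obj.map (homOfLE (le_top : specOpen f.1 ≤ ⊤)).op).hom
  have (f : s) : IsLocalization.Away f.1 Γ(Spec R, specOpen f.1) :=
    IsAffineOpen.instAwayCarrierObjOppositeOpensCarrierCarrierCommRingCatSpecPresheafOpOpensBasicOpen
  exact Module.Finite.of_localizationSpan' s hs
    (Rₚ := fun f => Γ(Spec R, specOpen f.1)) ρ (h₂ := fun f => hloc f.1) fun f => f.2

/-- The sections of a coherent sheaf on every affine open subset `U` are finitely generated: each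
point of `U` has a principal open neighbourhood inside a member of the given affine cover. -/
theorem finite_sections_of_isCoherent (hE : IsCoherent E) {U : X.Opens} (hU : IsAffineOpen U) :
    Module.Finite Γ(X, U) Γ(E, U) := by
  let c := hU.fromSpec
  let M := (Scheme.Modules.pullback c).obj E
  have hM : M.IsQuasicoherent := isQuasicoherent_pullback_of_isOpenImmersion c E
  have hcU : c.opensRange = U := hU.opensRange_fromSpec
  have hc : ⊤ ≤ c ⁻¹ᵁ U := fun x _ => hcU.le ⟨x, rfl⟩
  have h1 : Module.Finite Γ(X, U) Γ(M, ⊤) := by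
    refine finite_of_finite_specOpen M fun y => ?_
    obtain ⟨V, hyV, hV, hfin⟩ := hE.2 (c y)
    obtain ⟨_, ⟨_, ⟨f, rfl⟩, rfl⟩, hyf, hfV⟩ :=
      PrimeSpectrum.isBasis_basic_opens.exists_subset_of_mem_open
        (show y ∈ (c ⁻¹ᵁ V : Set _) from hyV) (c ⁻¹ᵁ V).isOpen
    refine ⟨f, hyf, ?_⟩
    let D : (Spec Γ(X, U)).Opens := specOpen f
    have hD : IsAffineOpen D := IsAffineOpen.Spec_basicOpen f
    have hcD : IsAffineOpen (c ''ᵁ D) := hD.image_of_isOpenImmersion c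
    have hle : c ''ᵁ D ≤ V := by
      rintro _ ⟨z, hz, rfl⟩
      exact hfV hz
    have := finite_sections_of_le E hV hcD hle
    have hDc : D ≤ c ⁻¹ᵁ (c ''ᵁ D) := fun z hz => ⟨z, hz, rfl⟩
    refine finite_of_semilinear_surjective _ (pullSec c E (c ''ᵁ D) D hDc) ?_
      (pullSec_smul _ _ _ _ _)
    rw [Set.range_eq_univ.2 (pullSec_bijective c E _ D hDc rfl).2, Submodule.span_univ]
  have h2 : Module.Finite Γ(Spec Γ(X, U), ⊤) Γ(M, ⊤) :=
    Module.Finite.of_restrictScalars_finite Γ(X, U) _ _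
  exact finite_of_semilinear_bijective _ (appLE_bijective c U hc hcU.ge).2 (pullSec c E U ⊤ hc)
    (pullSec_bijective c E U ⊤ hc (by rw [Scheme.Hom.image_top_eq_opensRange, hcU]))
    (pullSec_smul _ _ _ _ _)

end FiniteSections

end Toric

/-! ### The open subset `T × U_σ` -/

namespace Toric

section ProdOpen

open MonoidalCategory CartesianMonoidalCategory

variable (k : Type u) [Field k] {n : ℕ} (Δ : Fan n) (σ : Δ.cones)

lemma isAffineOpen_chartOpen : IsAffineOpen (chartOpen k Δ σ) :=
  isAffineOpen_opensRange (chart k Δ σ)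

lemma pull_bijective {Z : Scheme.{u}} {A : Type u} [CommRing A] (f : Z ⟶ Spec (.of A)) [IsIso f] :
    Function.Bijective (pull f) :=
  have : IsIso f.appTop := inferInstanceAs (IsIso (f.app ⊤))
  have : IsIso ((Scheme.ΓSpecIso (.of A)).inv ≫ f.appTop) := IsIso.comp_isIso
  (ConcreteCategory.isIso_iff_bijective ((Scheme.ΓSpecIso (.of A)).inv ≫ f.appTop)).1 this

/-- The functions on `T × U_τ`, i.e. the elements of `k[M] ⊗ k[τ_M]`, are sums of products of
characters of `T` and functions on `U_τ`. -/
lemma closure_pull_mul_pull (τ : PointedCone ℝ (Fin n → ℝ))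
    (f : Γ((torus k n ⊗ affineOver k τ).left, ⊤)) :
    f ∈ AddSubmonoid.closure (Set.range fun x : (Fin n → ℤ) × CoordRing k τ =>
      pull (fst (torus k n) (affineOver k τ)).left (AddMonoidAlgebra.single x.1 1) *
        pull (snd (torus k n) (affineOver k τ)).left x.2) := by
  let A := AddMonoidAlgebra k (Fin n → ℤ)
  let B := CoordRing k τ
  let w : (torus k n ⊗ affineOver k τ).left ⟶ Spec (.of (TensorProduct k A B)) :=
    (pullbackSpecIso k A B).hom
  have hw : IsIso w := inferInstanceAs (IsIso (pullbackSpecIso k A B).hom)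
  have h1 : w ≫ Spec.map (CommRingCat.ofHom
      (Algebra.TensorProduct.includeLeftRingHom : A →+* TensorProduct k A B)) =
      (fst (torus k n) (affineOver k τ)).left := pullbackSpecIso_hom_fst k A B
  have h2 : w ≫ Spec.map (CommRingCat.ofHom
      (Algebra.TensorProduct.includeRight : B →ₐ[k] TensorProduct k A B).toRingHom) =
      (snd (torus k n) (affineOver k τ)).left := pullbackSpecIso_hom_snd k A B
  obtain ⟨z, rfl⟩ := (pull_bijective w).2 f
  induction z using TensorProduct.induction_on with
  | zero => rw [map_zero]; exact zero_mem _
  | add x y hx hy => rw [map_add]; exact add_mem hx hy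
  | tmul a b =>
    induction a using AddMonoidAlgebra.induction_linear with
    | zero => rw [TensorProduct.zero_tmul, map_zero]; exact zero_mem _
    | add x y hx hy => rw [TensorProduct.add_tmul, map_add]; exact add_mem hx hy
    | single m c =>
      -- `c χ(m) ⊗ b = χ(m) ⊗ c b`
      refine AddSubmonoid.subset_closure ⟨(m, c • b), ?_⟩
      have e : (AddMonoidAlgebra.single m c : A) = c • AddMonoidAlgebra.single m 1 := by simp
      rw [← h1, ← h2, pull_comp_SpecMap, pull_comp_SpecMap]
      simp only [RingHom.comp_apply]
      rw [← map_mul, e, TensorProduct.smul_tmul]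
      congr 1
      change (AddMonoidAlgebra.single m 1 ⊗ₜ[k] (1 : B)) * ((1 : A) ⊗ₜ[k] (c • b)) = _
      rw [Algebra.TensorProduct.tmul_mul_tmul, one_mul, mul_one]

/-- The inclusion of `T × U_σ` in `T × X_Δ`. -/
def prodChart : torus k n ⊗ affineOver k σ.1 ⟶ torus k n ⊗ toricOver k Δ :=
  torus k n ◁ chartOver k Δ σ

lemma prodChart_snd :
    prodChart k Δ σ ≫ snd (torus k n) (toricOver k Δ) = snd _ _ ≫ chartOver k Δ σ :=
  whiskerLeft_snd _ _

lemma prodChart_fst :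
    prodChart k Δ σ ≫ fst (torus k n) (toricOver k Δ) = fst _ _ :=
  whiskerLeft_fst _ _

/-- The product `T × U_σ` is the preimage of `U_σ` under the projection `T × X_Δ → X_Δ`. -/
def prodChartIso : torus k n ⊗ affineOver k σ.1 ≅
    piece k Δ (snd (torus k n) (toricOver k Δ)) σ where
  hom := pieceLift k Δ _ (prodChart k Δ σ) (snd _ _) (prodChart_snd k Δ σ)
  inv := lift (pieceIncl k Δ _ σ ≫ fst _ _) (pieceProj k Δ _ σ)
  hom_inv_id := by
    apply CartesianMonoidalCategory.hom_ext
    · rw [Category.assoc, lift_fst, ← Category.assoc, pieceLift_incl, prodChart_fst,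
        Category.id_comp]
    · rw [Category.assoc, lift_snd, pieceLift_proj, Category.id_comp]
  inv_hom_id := by
    have h1 : (lift (pieceIncl k Δ (snd (torus k n) (toricOver k Δ)) σ ≫ fst _ _)
        (pieceProj k Δ _ σ) ≫ pieceLift k Δ (snd (torus k n) (toricOver k Δ)) (prodChart k Δ σ)
          (snd _ _) (prodChart_snd k Δ σ)) ≫ pieceIncl k Δ _ σ = 𝟙 _ ≫ pieceIncl k Δ _ σ := by
      rw [Category.assoc, pieceLift_incl, Category.id_comp]
      apply CartesianMonoidalCategory.hom_ext
      · rw [Category.assoc, prodChart_fst, lift_fst]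
      · rw [Category.assoc, prodChart_snd, lift_snd_assoc, piece_condition]
    have h2 : (lift (pieceIncl k Δ (snd (torus k n) (toricOver k Δ)) σ ≫ fst _ _)
        (pieceProj k Δ _ σ) ≫ pieceLift k Δ (snd (torus k n) (toricOver k Δ)) (prodChart k Δ σ)
          (snd _ _) (prodChart_snd k Δ σ)) ≫ pieceProj k Δ _ σ = 𝟙 _ ≫ pieceProj k Δ _ σ := by
      rw [Category.assoc, pieceLift_proj, Category.id_comp, lift_snd]
    apply Over.OverMorphism.ext
    exact pullback.hom_ext (congrArg (·.left) h1) (congrArg (·.left) h2)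

lemma prodChart_eq : prodChart k Δ σ = (prodChartIso k Δ σ).hom ≫ pieceIncl k Δ _ σ :=
  (pieceLift_incl k Δ _ _ _ (prodChart_snd k Δ σ)).symm

instance : IsOpenImmersion (prodChart k Δ σ).left := by
  rw [prodChart_eq, Over.comp_left]
  have : IsIso (prodChartIso k Δ σ).hom.left :=
    inferInstanceAs (IsIso ((Over.forget _).map (prodChartIso k Δ σ).hom))
  exact MorphismProperty.comp_mem @IsOpenImmersion _ _ inferInstance inferInstance

lemma opensRange_prodChart : (prodChart k Δ σ).left.opensRange = prodOpen k Δ σ := by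
  apply TopologicalSpace.Opens.ext
  have : IsIso (prodChartIso k Δ σ).hom.left :=
    inferInstanceAs (IsIso ((Over.forget _).map (prodChartIso k Δ σ).hom))
  have e : Set.range (prodChart k Δ σ).left = Set.range ((prodChartIso k Δ σ).hom.left ≫
      (pieceIncl k Δ (snd (torus k n) (toricOver k Δ)) σ).left) := by
    rw [prodChart_eq, Over.comp_left]
  refine Eq.trans e (Eq.trans ?_ (range_pieceIncl k Δ σ))
  rw [Scheme.Hom.comp_base, TopCat.coe_comp, Set.range_comp,
    (prodChartIso k Δ σ).hom.left.surjective.range_eq, Set.image_univ]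

lemma isAffineOpen_prodOpen : IsAffineOpen (prodOpen k Δ σ) := by
  rw [← opensRange_prodChart]
  let w : (torus k n ⊗ affineOver k σ.1).left ⟶
      Spec (.of (TensorProduct k (AddMonoidAlgebra k (Fin n → ℤ)) (CoordRing k σ.1))) :=
    (pullbackSpecIso k _ _).hom
  have hw : IsIso w := inferInstanceAs (IsIso (pullbackSpecIso k _ _).hom)
  have : IsAffine (torus k n ⊗ affineOver k σ.1).left := IsAffine.of_isIso w
  exact isAffineOpen_opensRange (prodChart k Δ σ).left

lemma le_preimage_prodOpen : ⊤ ≤ (prodChart k Δ σ).left ⁻¹ᵁ prodOpen k Δ σ :=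
  fun x _ => (opensRange_prodChart k Δ σ).le ⟨x, rfl⟩

/-- The functions on the open subset `T × U_σ` of `T × X_Δ` are sums of products of characters of
`T` and functions on `U_σ`. -/
lemma closure_charFun_mul (f : Γ((torus k n ⊗ toricOver k Δ).left, prodOpen k Δ σ)) :
    f ∈ AddSubmonoid.closure (Set.range fun x : (Fin n → ℤ) × CoordRing k σ.1 =>
      charFun k Δ σ x.1 * (projMap (torus k n) (toricOver k Δ)).left.appLE (chartOpen k Δ σ)
        (prodOpen k Δ σ) le_rfl (coord k Δ σ x.2)) := by
  let j := (prodChart k Δ σ).left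
  have hj := le_preimage_prodOpen k Δ σ
  have hbij := appLE_bijective j (prodOpen k Δ σ) hj (opensRange_prodChart k Δ σ).ge
  have e1 : ∀ m, j.appLE (prodOpen k Δ σ) ⊤ hj (charFun k Δ σ m) =
      pull (fst (torus k n) (affineOver k σ.1)).left (AddMonoidAlgebra.single m 1) := by
    intro m
    have h1 : j ≫ (fst (torus k n) (toricOver k Δ)).left =
        (fst (torus k n) (affineOver k σ.1)).left := by
      exact congrArg (·.left) (whiskerLeft_fst (torus k n) (chartOver k Δ σ))
    rw [← h1]
    refine Eq.trans ?_ (pull_comp_apply j (fst (torus k n) (toricOver k Δ)).left _).symm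
    have := Scheme.Hom.map_appLE j hj (homOfLE (le_top : prodOpen k Δ σ ≤ ⊤)).op
    refine (ConcreteCategory.congr_hom this _).trans ?_
    exact (ConcreteCategory.congr_hom (appTop_eq_appLE j _) _).symm
  have h2 : j ≫ (projMap (torus k n) (toricOver k Δ)).left =
      (snd (torus k n) (affineOver k σ.1)).left ≫ chart k Δ σ :=
    congrArg (·.left) (whiskerLeft_snd (torus k n) (chartOver k Δ σ))
  have e2 : ∀ b, j.appLE (prodOpen k Δ σ) ⊤ hj
      ((projMap (torus k n) (toricOver k Δ)).left.appLE (chartOpen k Δ σ)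
        (prodOpen k Δ σ) le_rfl (coord k Δ σ b)) =
      pull (snd (torus k n) (affineOver k σ.1)).left b := by
    intro b
    refine (ConcreteCategory.congr_hom (Scheme.Hom.appLE_comp_appLE j
      (projMap (torus k n) (toricOver k Δ)).left (chartOpen k Δ σ) (prodOpen k Δ σ) ⊤ le_rfl hj)
      (coord k Δ σ b)).trans ?_
    exact appLE_coord k Δ σ h2 b (le_preimage_chartOpen k Δ σ h2)
  have key : ∀ g, g ∈ AddSubmonoid.closure (Set.range fun x : (Fin n → ℤ) × CoordRing k σ.1 =>
      pull (fst (torus k n) (affineOver k σ.1)).left (AddMonoidAlgebra.single x.1 1) *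
        pull (snd (torus k n) (affineOver k σ.1)).left x.2) →
      ∃ f ∈ AddSubmonoid.closure (Set.range fun x : (Fin n → ℤ) × CoordRing k σ.1 =>
      charFun k Δ σ x.1 * (projMap (torus k n) (toricOver k Δ)).left.appLE (chartOpen k Δ σ)
        (prodOpen k Δ σ) le_rfl (coord k Δ σ x.2)), j.appLE (prodOpen k Δ σ) ⊤ hj f = g := by
    intro g hg
    induction hg using AddSubmonoid.closure_induction with
    | zero => exact ⟨0, zero_mem _, map_zero _⟩
    | add a b _ _ ha hb =>
      obtain ⟨a', ha', rfl⟩ := ha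
      obtain ⟨b', hb', rfl⟩ := hb
      exact ⟨a' + b', add_mem ha' hb', map_add _ _ _⟩
    | mem x hx =>
      obtain ⟨x, rfl⟩ := hx
      refine ⟨_, AddSubmonoid.subset_closure ⟨x, rfl⟩, ?_⟩
      simp only
      rw [map_mul, e1, e2]
  obtain ⟨f', hf', e⟩ := key _ (closure_pull_mul_pull k σ.1 (j.appLE (prodOpen k Δ σ) ⊤ hj f))
  rw [← hbij.1 e]
  exact hf'

end ProdOpen

end Toric

/-! ### Points of the torus and independence of characters -/

namespace Toric

section Dedekind

variable {k : Type u} [Field k] {n : ℕ}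

/-- The value of the character `χ(m)` at a `k`-point of the torus, as a function of the point. The
`k`-points of `T` are the homomorphisms `M → kˣ`. -/
def charEval (k : Type u) [Field k] {n : ℕ} (m : Fin n → ℤ) :
    (Multiplicative (Fin n → ℤ) →* kˣ) →* k :=
  (Units.coeHom k).comp (MonoidHom.eval (Multiplicative.ofAdd m))

/-- Over an infinite field, characters of the torus are determined by their values at the
`k`-points. -/
lemma charEval_injective [Infinite k] : Function.Injective (charEval k (n := n)) := by
  intro m m' h
  by_contra hne
  obtain ⟨i, hi⟩ := Function.ne_iff.1 hne
  -- for `m i ≠ m' i`, the characters differ at the point `e_i ↦ c`, `e_j ↦ 1` for general `c`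
  obtain ⟨c, hc⟩ : ∃ c : kˣ, c ^ (m i - m' i) ≠ 1 := by
    by_contra! hall
    have hd : (m i - m' i).natAbs ≠ 0 := by omega
    have : NeZero (m i - m' i).natAbs := ⟨hd⟩
    have hfin : Finite (rootsOfUnity (m i - m' i).natAbs k) := inferInstance
    have htop : rootsOfUnity (m i - m' i).natAbs k = ⊤ := by
      refine top_le_iff.1 fun c _ => ?_
      rw [mem_rootsOfUnity]
      rcases Int.natAbs_eq (m i - m' i) with e | e
      · have := hall c
        rw [e, zpow_natCast] at this
        exact this
      · have := hall c
        rw [e, zpow_neg, zpow_natCast, inv_eq_one] at this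
        exact this
    rw [htop] at hfin
    have : Finite kˣ := Finite.of_equiv _ (Subgroup.topEquiv (G := kˣ)).toEquiv
    refine Set.infinite_univ (α := k) (((Set.finite_range (Units.val : kˣ → k)).insert 0).subset ?_)
    intro x _
    by_cases hx : x = 0
    · exact Or.inl hx
    · exact Or.inr ⟨Units.mk0 x hx, rfl⟩
  apply hc
  have := DFunLike.congr_fun h ((zpowersHom kˣ c).comp
    (AddMonoidHom.toMultiplicative (Pi.evalAddMonoidHom (fun _ : Fin n => ℤ) i)))
  have h2 : c ^ m i = c ^ m' i := Units.ext this
  rw [zpow_sub, h2, mul_inv_cancel]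

/-- Linear independence of characters, for coefficients in a vector space. -/
lemma eq_zero_of_sum_charEval_smul [Infinite k] {V : Type*} [AddCommGroup V] [Module k V]
    (I : Finset (Fin n → ℤ)) (s : (Fin n → ℤ) → V)
    (h : ∀ t : Multiplicative (Fin n → ℤ) →* kˣ, ∑ m ∈ I, charEval k m t • s m = 0) :
    ∀ m ∈ I, s m = 0 := by
  intro m hm
  rw [← Module.forall_dual_apply_eq_zero_iff k]
  intro l
  have hli : LinearIndependent k (fun m : Fin n → ℤ =>
      (charEval k m : (Multiplicative (Fin n → ℤ) →* kˣ) → k)) :=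
    (linearIndependent_monoidHom (Multiplicative (Fin n → ℤ) →* kˣ) k).comp _ charEval_injective
  refine linearIndependent_iff'.1 hli I (fun m => l (s m)) ?_ m hm
  ext t
  have := congrArg l (h t)
  rw [map_sum, map_zero] at this
  simp only [map_smul, smul_eq_mul] at this
  simpa [mul_comm] using this

end Dedekind

section TorusPoints

open MonoidalCategory CartesianMonoidalCategory

variable {k : Type u} [Field k] {n : ℕ}

/-- A `k`-point of the torus `T`, as a constant morphism from a scheme `Z` over `k`. -/
def constPoint (Z : Over (Spec (.of k))) (t : Multiplicative (Fin n → ℤ) →* kˣ) : Z ⟶ torus k n :=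
  Over.homMk (Z.hom ≫ Spec.map (CommRingCat.ofHom
    (AddMonoidAlgebra.lift k k (Fin n → ℤ) ((Units.coeHom k).comp t)).toRingHom)) (by
      change (Z.hom ≫ Spec.map _) ≫ Spec.map (CommRingCat.ofHom (algebraMap k _)) = _
      rw [Category.assoc, ← Spec.map_comp, ← CommRingCat.ofHom_comp]
      have : (AddMonoidAlgebra.lift k k (Fin n → ℤ) ((Units.coeHom k).comp t)).toRingHom.comp
          (algebraMap k (AddMonoidAlgebra k (Fin n → ℤ))) = RingHom.id k :=
        (AddMonoidAlgebra.lift k k (Fin n → ℤ) ((Units.coeHom k).comp t)).comp_algebraMap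
      rw [this]
      exact (congrArg (Z.hom ≫ ·) (Spec.map_id _)).trans (Category.comp_id _))

lemma pull_constPoint (Z : Over (Spec (.of k))) (t : Multiplicative (Fin n → ℤ) →* kˣ)
    (m : Fin n → ℤ) : pull (constPoint Z t).left (AddMonoidAlgebra.single m 1) =
      pull Z.hom (charEval k m t) := by
  refine (RingHom.congr_fun (pull_comp_SpecMap Z.hom _) _).trans ?_
  refine congrArg (pull Z.hom) ?_
  refine (AddMonoidAlgebra.lift_single _ _ _).trans ?_
  rw [one_smul]
  rfl

variable {Δ : Fan n} (σ : Δ.cones)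

lemma appLE_charFun {Y : Over (Spec (.of k))} (h : Y ⟶ torus k n ⊗ toricOver k Δ)
    {V : Y.left.Opens} (hV : V ≤ h.left ⁻¹ᵁ prodOpen k Δ σ) (m : Fin n → ℤ) :
    h.left.appLE (prodOpen k Δ σ) V hV (charFun k Δ σ m) =
      Y.left.presheaf.map (homOfLE le_top).op
        (pull (h ≫ fst _ _).left (AddMonoidAlgebra.single m 1)) := by
  refine Eq.trans ?_ (congrArg (Y.left.presheaf.map (homOfLE le_top).op)
    (pull_comp_apply h.left (fst (torus k n) (toricOver k Δ)).left _)).symm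
  have := Scheme.Hom.map_appLE h.left hV (homOfLE (le_top : prodOpen k Δ σ ≤ ⊤)).op
  exact ConcreteCategory.congr_hom this _

/-- The two ways in which `k` acts on the functions on `U_σ` agree. -/
lemma map_pull_toricHom (c : k) :
    (toricOver k Δ).left.presheaf.map (homOfLE (le_top : chartOpen k Δ σ ≤ ⊤)).op
      (pull (toricOver k Δ).hom c) = coord k Δ σ (algebraMap k (CoordRing k σ.1) c) := by
  have hf : chart k Δ σ = 𝟙 _ ≫ chart k Δ σ := (Category.id_comp _).symm
  have hj := le_preimage_chartOpen k Δ σ hf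
  apply (appLE_bijective (chart k Δ σ) (chartOpen k Δ σ) hj le_rfl).1
  refine Eq.trans ?_ (appLE_coord k Δ σ hf _ hj).symm
  have h1 := Scheme.Hom.map_appLE (chart k Δ σ) hj (homOfLE (le_top : chartOpen k Δ σ ≤ ⊤)).op
  refine (ConcreteCategory.congr_hom h1 _).trans ?_
  refine (ConcreteCategory.congr_hom (appTop_eq_appLE (chart k Δ σ) _).symm _).trans ?_
  refine (pull_comp_apply (chart k Δ σ) (toricHom k Δ) c).symm.trans ?_
  rw [chart_toricHom]
  have := pull_comp_SpecMap (𝟙 (Spec (.of (CoordRing k σ.1)))) (algebraMap k (CoordRing k σ.1))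
  rw [Category.id_comp] at this
  exact RingHom.congr_fun this c

/-- If a morphism `U_σ → T × U_σ` has a constant first component `t`, then it pulls back `χ(m)` to
the constant `χ(m)(t)`. -/
lemma appLE_charFun_of_const (h : toricOver k Δ ⟶ torus k n ⊗ toricOver k Δ)
    (hV : chartOpen k Δ σ ≤ h.left ⁻¹ᵁ prodOpen k Δ σ) (m : Fin n → ℤ) (c : k)
    (hc : pull (h ≫ fst _ _).left (AddMonoidAlgebra.single m 1) = pull (toricOver k Δ).hom c) :
    h.left.appLE (prodOpen k Δ σ) (chartOpen k Δ σ) hV (charFun k Δ σ m) =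
      coord k Δ σ (algebraMap k (CoordRing k σ.1) c) := by
  rw [appLE_charFun, hc, map_pull_toricHom]

end TorusPoints

end Toric

/-! ### The cocycle condition on sections, and restriction to points of the torus -/

namespace Toric

section Cocycle

variable {W Y Z : Scheme.{u}}

lemma comp_app_apply {E F G : W.Modules} (f : E ⟶ F) (g : F ⟶ G) (V : W.Opens) (x : Γ(E, V)) :
    (f ≫ g).app V x = g.app V (f.app V x) := rfl

/-- The cocycle condition, evaluated on a section: if `φ(a^*s) = ∑ rᵢ p^*tᵢ` and
`φ(a^*tᵢ) = ∑ rᵢⱼ p^*uᵢⱼ`, then `∑ m^*(rᵢ) p₂^*tᵢ = ∑ d^*(rᵢ) q^*(rᵢⱼ) p₂^*uᵢⱼ`, where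
`p₂ = p ∘ m = p ∘ q`. -/
lemma IsCocycle.sum_eq {a p : Y ⟶ Z} {m d q : W ⟶ Y} {h₁ : m ≫ a = d ≫ a} {h₂ : d ≫ p = q ≫ a}
    {h₃ : q ≫ p = m ≫ p} {E : Z.Modules}
    {φ : (Scheme.Modules.pullback a).obj E ⟶ (Scheme.Modules.pullback p).obj E}
    (h : IsCocycle h₁ h₂ h₃ φ) {U : Z.Opens} {V : Y.Opens} {V' : W.Opens}
    (ha : V ≤ a ⁻¹ᵁ U) (hp : V ≤ p ⁻¹ᵁ U) (hm : V' ≤ m ⁻¹ᵁ V) (hd : V' ≤ d ⁻¹ᵁ V)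
    (hq : V' ≤ q ⁻¹ᵁ V) (hmp : V' ≤ (m ≫ p) ⁻¹ᵁ U) {ι κ : Type*} (I : Finset ι) (J : ι → Finset κ)
    (r : ι → Γ(Y, V)) (r' : ι → κ → Γ(Y, V)) (s : Γ(E, U)) (t : ι → Γ(E, U))
    (v : ι → κ → Γ(E, U))
    (hs : φ.app V (pullSec a E U V ha s) = ∑ i ∈ I, r i • pullSec p E U V hp (t i))
    (ht : ∀ i ∈ I, φ.app V (pullSec a E U V ha (t i)) =
      ∑ j ∈ J i, r' i j • pullSec p E U V hp (v i j)) :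
    ∑ i ∈ I, m.appLE V V' hm (r i) • pullSec (m ≫ p) E U V' hmp (t i) =
      ∑ i ∈ I, d.appLE V V' hd (r i) • ∑ j ∈ J i, q.appLE V V' hq (r' i j) •
        pullSec (m ≫ p) E U V' hmp (v i j) := by
  have hma : V' ≤ (m ≫ a) ⁻¹ᵁ U := fun x hx => ha (hm hx)
  have hda : V' ≤ (d ≫ a) ⁻¹ᵁ U := fun x hx => ha (hd hx)
  have hdp : V' ≤ (d ≫ p) ⁻¹ᵁ U := fun x hx => hp (hd hx)
  have hqa : V' ≤ (q ≫ a) ⁻¹ᵁ U := fun x hx => ha (hq hx)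
  have hqp : V' ≤ (q ≫ p) ⁻¹ᵁ U := fun x hx => hp (hq hx)
  have e1 := pullHom_pullSec m φ ha hp hm hma hmp I r t s hs
  have h' : pullHom m φ = (Scheme.Modules.pullbackCongr h₁).hom.app E ≫ pullHom d φ ≫
    (Scheme.Modules.pullbackCongr h₂).hom.app E ≫ pullHom q φ ≫
    (Scheme.Modules.pullbackCongr h₃).hom.app E := h
  refine Eq.trans e1.symm ?_
  rw [h', comp_app_apply, comp_app_apply, comp_app_apply, comp_app_apply]
  rw [pullbackCongr_hom_pullSec h₁ E hma hda, pullHom_pullSec d φ ha hp hd hda hdp I r t s hs,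
    map_sum, map_sum, map_sum]
  refine Finset.sum_congr rfl fun i hi => ?_
  rw [Scheme.Modules.Hom.app_smul, Scheme.Modules.Hom.app_smul, Scheme.Modules.Hom.app_smul,
    pullbackCongr_hom_pullSec h₂ E hdp hqa,
    pullHom_pullSec q φ ha hp hq hqa hqp (J i) (r' i) (v i) (t i) (ht i hi), map_sum]
  congr 1
  refine Finset.sum_congr rfl fun j _ => ?_
  rw [Scheme.Modules.Hom.app_smul, pullbackCongr_hom_pullSec h₃ E hqp hmp]

end Cocycle

section Evaluation

open MonoidalCategory CartesianMonoidalCategory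

variable {k : Type u} [Field k] {n : ℕ} {Δ : Fan n}
  (E : EquivariantQCoh (torus k n) (toricOver k Δ)) (σ : Δ.cones)

variable (k Δ) in
/-- The section `x ↦ (t, x)` of the projection `T × X_Δ → X_Δ`. -/
def pointSection (t : Multiplicative (Fin n → ℤ) →* kˣ) :
    toricOver k Δ ⟶ torus k n ⊗ toricOver k Δ :=
  lift (constPoint _ t) (𝟙 _)

lemma pointSection_projMap (t : Multiplicative (Fin n → ℤ) →* kˣ) :
    (pointSection k Δ t).left ≫ (projMap (torus k n) (toricOver k Δ)).left = 𝟙 _ :=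
  congrArg (·.left) (lift_snd (constPoint (toricOver k Δ) t) (𝟙 _))

lemma le_preimage_pointSection (t : Multiplicative (Fin n → ℤ) →* kˣ) :
    chartOpen k Δ σ ≤ (pointSection k Δ t).left ⁻¹ᵁ prodOpen k Δ σ := by
  have h : chartOpen k Δ σ ≤ ((pointSection k Δ t).left ≫
      (projMap (torus k n) (toricOver k Δ)).left) ⁻¹ᵁ chartOpen k Δ σ := by
    rw [pointSection_projMap]; exact le_rfl
  exact h

/-- The restriction of a section of `p^*E` to `{t} × U_σ`. -/
def evalPoint (t : Multiplicative (Fin n → ℤ) →* kˣ) : Γ((Scheme.Modules.pullback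
    (projMap (torus k n) (toricOver k Δ)).left).obj E.sheaf, prodOpen k Δ σ) →+
    ChartSections E σ :=
  sectionPull (pointSection k Δ t).left _ (pointSection_projMap t) E.sheaf (chartOpen k Δ σ)
    (prodOpen k Δ σ) (le_preimage_pointSection σ t)

lemma evalPoint_trivialCoaction (t : Multiplicative (Fin n → ℤ) →* kˣ) (s : ChartSections E σ) :
    evalPoint E σ t (trivialCoaction E σ s) = s :=
  sectionPull_pullSec _ _ _ _ _ _ _ _ s

lemma coord_bijective : Function.Bijective (coord k Δ σ) := by
  have : Function.Bijective (pull (chart k Δ σ).isoOpensRange.inv) := pull_bijective _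
  exact ((ConcreteCategory.isIso_iff_bijective
    (chart k Δ σ).opensRange.topIso.hom).1 inferInstance).comp this

lemma exists_evalPoint_smul (t : Multiplicative (Fin n → ℤ) →* kˣ)
    (f : Γ((torus k n ⊗ toricOver k Δ).left, prodOpen k Δ σ)) :
    ∃ b : CoordRing k σ.1, ∀ x, evalPoint E σ t (f • x) = b • evalPoint E σ t x := by
  obtain ⟨b, hb⟩ := (coord_bijective (k := k) σ).2
    ((pointSection k Δ t).left.appLE _ _ (le_preimage_pointSection σ t) f)
  refine ⟨b, fun x => ?_⟩
  refine (sectionPull_smul _ _ _ _ _ _ _ _ _).trans ?_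
  rw [← hb]
  rfl

lemma evalPoint_charFun_smul (t : Multiplicative (Fin n → ℤ) →* kˣ) (m : Fin n → ℤ) (x) :
    evalPoint E σ t (charFun k Δ σ m • x) = charEval k m t • evalPoint E σ t x := by
  refine (sectionPull_smul _ _ _ _ _ _ _ _ _).trans ?_
  rw [appLE_charFun_of_const σ (pointSection k Δ t) (le_preimage_pointSection σ t) m
    (charEval k m t)]
  · rfl
  · rw [pointSection, lift_fst]
    exact pull_constPoint _ t m

/-- Every section of `p^*E` on `T × U_σ` is a sum of sections `χ(m) p^*s`. -/
lemma exists_eq_sum_trivialCoaction (x : Γ((Scheme.Modules.pullback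
    (projMap (torus k n) (toricOver k Δ)).left).obj E.sheaf, prodOpen k Δ σ)) :
    ∃ s : (Fin n → ℤ) →₀ ChartSections E σ,
      x = s.sum fun m v => charFun k Δ σ m • trivialCoaction E σ v := by
  have : E.sheaf.IsQuasicoherent := E.quasicoherent
  have hx : x ∈ Submodule.span Γ((torus k n ⊗ toricOver k Δ).left, prodOpen k Δ σ)
      (Set.range (trivialCoaction E σ)) := by
    have := span_range_pullSec (projMap (torus k n) (toricOver k Δ)).left E.sheaf
      (isAffineOpen_chartOpen k Δ σ) (isAffineOpen_prodOpen k Δ σ) le_rfl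
    exact this.symm ▸ Submodule.mem_top
  have hadd : ∀ s s' : (Fin n → ℤ) →₀ ChartSections E σ,
      (s + s').sum (fun m v => charFun k Δ σ m • trivialCoaction E σ v) =
      s.sum (fun m v => charFun k Δ σ m • trivialCoaction E σ v) +
      s'.sum (fun m v => charFun k Δ σ m • trivialCoaction E σ v) := fun s s' =>
    Finsupp.sum_add_index' (fun m => by rw [map_zero, smul_zero])
      (fun m v w => by rw [map_add, smul_add])
  rw [← Submodule.mem_toAddSubmonoid, Submodule.span_eq_closure] at hx
  induction hx using AddSubmonoid.closure_induction with
  | zero => exact ⟨0, by rw [Finsupp.sum_zero_index]⟩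
  | add x y _ _ hx hy =>
    obtain ⟨s, rfl⟩ := hx
    obtain ⟨s', rfl⟩ := hy
    exact ⟨s + s', (hadd s s').symm⟩
  | mem x hx =>
    obtain ⟨f, -, _, ⟨v, rfl⟩, rfl⟩ := hx
    change ∃ s : (Fin n → ℤ) →₀ ChartSections E σ, f • trivialCoaction E σ v = _
    have hf := closure_charFun_mul k Δ σ f
    induction hf using AddSubmonoid.closure_induction with
    | zero => exact ⟨0, by rw [Finsupp.sum_zero_index, zero_smul]⟩
    | add x y _ _ hx hy =>
      obtain ⟨s, hs⟩ := hx
      obtain ⟨s', hs'⟩ := hy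
      exact ⟨s + s', by rw [hadd, add_smul, hs, hs']⟩
    | mem x hx =>
      obtain ⟨⟨m, b⟩, rfl⟩ := hx
      refine ⟨Finsupp.single m (b • v), ?_⟩
      rw [Finsupp.sum_single_index (by rw [map_zero, smul_zero]), trivialCoaction_smul, mul_smul]

/-- Sections of different degrees are linearly independent. -/
lemma eq_zero_of_sum_weightSpace [Infinite k] (I : Finset (Fin n → ℤ))
    (s : (Fin n → ℤ) → ChartSections E σ) (hs : ∀ m ∈ I, s m ∈ weightSpace E σ m)
    (h : ∑ m ∈ I, s m = 0) : ∀ m ∈ I, s m = 0 := by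
  refine eq_zero_of_sum_charEval_smul (k := k) I s fun t => ?_
  have := congrArg (fun x => evalPoint E σ t (coaction E σ x)) h
  simp only [map_sum, map_zero] at this
  rw [← this]
  refine Finset.sum_congr rfl fun m hm => ?_
  have h1 : coaction E σ (s m) = charFun k Δ σ m • trivialCoaction E σ (s m) := hs m hm
  rw [h1, evalPoint_charFun_smul, evalPoint_trivialCoaction]

end Evaluation

end Toric

/-! ### The grading on the sections over `U_σ` -/

namespace Toric

section Decomposition

open MonoidalCategory CartesianMonoidalCategory

variable {k : Type u} [Field k] {n : ℕ} {Δ : Fan n}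
  (E : EquivariantQCoh (torus k n) (toricOver k Δ)) (σ : Δ.cones)

variable (k Δ) in
/-- The morphism `x ↦ (t, t', x)` from `X_Δ` to `T × (T × X_Δ)`. -/
def pairSection (t t' : Multiplicative (Fin n → ℤ) →* kˣ) :
    toricOver k Δ ⟶ torus k n ⊗ (torus k n ⊗ toricOver k Δ) :=
  lift (constPoint _ t) (pointSection k Δ t')

lemma pairSection_mulFace_projMap (t t' : Multiplicative (Fin n → ℤ) →* kˣ) :
    (pairSection k Δ t t').left ≫ ((mulFace (torus k n) (toricOver k Δ)).left ≫
      (projMap (torus k n) (toricOver k Δ)).left) = 𝟙 _ := by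
  have h : pairSection k Δ t t' ≫ (mulFace (torus k n) (toricOver k Δ) ≫
      projMap (torus k n) (toricOver k Δ)) = 𝟙 _ := by
    rw [mulFace_projMap, pairSection, lift_snd_assoc, pointSection, lift_snd]
  exact congrArg (·.left) h

lemma pairSection_mulFace_fst (t t' : Multiplicative (Fin n → ℤ) →* kˣ) :
    (pairSection k Δ t t' ≫ mulFace (torus k n) (toricOver k Δ)) ≫ fst _ _ =
      lift (constPoint _ t) (constPoint _ t') ≫ MonObj.mul := by
  have h : pairSection k Δ t t' ≫ (α_ (torus k n) (torus k n) (toricOver k Δ)).inv =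
      lift (lift (constPoint _ t) (constPoint _ t')) (𝟙 _) := by
    rw [pairSection, pointSection, lift_lift_associator_inv]
  rw [Category.assoc, Category.assoc, whiskerRight_fst, ← Category.assoc, h, lift_fst_assoc]

lemma pairSection_actFace_fst (t t' : Multiplicative (Fin n → ℤ) →* kˣ) :
    (pairSection k Δ t t' ≫ actFace (torus k n) (toricOver k Δ)) ≫ fst _ _ = constPoint _ t := by
  rw [Category.assoc, whiskerLeft_fst, pairSection, lift_fst]

lemma pairSection_projFace_fst (t t' : Multiplicative (Fin n → ℤ) →* kˣ) :
    (pairSection k Δ t t' ≫ projFace (torus k n) (toricOver k Δ)) ≫ fst _ _ = constPoint _ t' := by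
  rw [pairSection, lift_snd, pointSection, lift_fst]

variable (k) in
/-- The open subset `T × T × U_σ` of `T × T × X_Δ`. -/
def tripleOpen : (torus k n ⊗ (torus k n ⊗ toricOver k Δ)).left.Opens :=
  (mulFace (torus k n) (toricOver k Δ)).left ⁻¹ᵁ prodOpen k Δ σ

lemma tripleOpen_le_projFace :
    tripleOpen k σ ≤ (projFace (torus k n) (toricOver k Δ)).left ⁻¹ᵁ prodOpen k Δ σ := by
  have e : (projFace (torus k n) (toricOver k Δ)).left ≫
      (projMap (torus k n) (toricOver k Δ)).left =
      (mulFace (torus k n) (toricOver k Δ)).left ≫ (projMap (torus k n) (toricOver k Δ)).left :=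
    congrArg (·.left) (mulFace_projMap (torus k n) (toricOver k Δ)).symm
  have h : tripleOpen k σ ≤ ((projFace (torus k n) (toricOver k Δ)).left ≫
      (projMap (torus k n) (toricOver k Δ)).left) ⁻¹ᵁ chartOpen k Δ σ := by
    rw [e]; exact le_rfl
  exact h

lemma tripleOpen_le_actFace :
    tripleOpen k σ ≤ (actFace (torus k n) (toricOver k Δ)).left ⁻¹ᵁ prodOpen k Δ σ := by
  have e : (actFace (torus k n) (toricOver k Δ)).left ≫ (projMap (torus k n) (toricOver k Δ)).left =
      (projFace (torus k n) (toricOver k Δ)).left ≫ (actMap (torus k n) (toricOver k Δ)).left :=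
    congrArg (·.left) (actFace_projMap (torus k n) (toricOver k Δ))
  have h : tripleOpen k σ ≤ (projFace (torus k n) (toricOver k Δ)).left ⁻¹ᵁ
      ((actMap (torus k n) (toricOver k Δ)).left ⁻¹ᵁ chartOpen k Δ σ) :=
    (tripleOpen_le_projFace σ).trans
      (Scheme.Hom.preimage_mono _ (prodOpen_le k Δ σ))
  rw [← Scheme.Hom.comp_preimage, ← e] at h
  exact h

lemma le_preimage_pairSection (t t' : Multiplicative (Fin n → ℤ) →* kˣ) :
    chartOpen k Δ σ ≤ (pairSection k Δ t t').left ⁻¹ᵁ tripleOpen k σ := by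
  have h : chartOpen k Δ σ ≤ ((pairSection k Δ t t').left ≫
      ((mulFace (torus k n) (toricOver k Δ)).left ≫
        (projMap (torus k n) (toricOver k Δ)).left)) ⁻¹ᵁ chartOpen k Δ σ := by
    rw [pairSection_mulFace_projMap]; exact le_rfl
  exact h

/-- The restriction of a section of the pullback of `E` to `T × T × U_σ` to `{(t, t')} × U_σ`. -/
def evalPair (t t' : Multiplicative (Fin n → ℤ) →* kˣ) :
    Γ((Scheme.Modules.pullback ((mulFace (torus k n) (toricOver k Δ)).left ≫
      (projMap (torus k n) (toricOver k Δ)).left)).obj E.sheaf, tripleOpen k σ) →+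
    ChartSections E σ :=
  sectionPull (pairSection k Δ t t').left _ (pairSection_mulFace_projMap t t') E.sheaf
    (chartOpen k Δ σ) (tripleOpen k σ) (le_preimage_pairSection σ t t')

lemma evalPair_pullSec (t t' : Multiplicative (Fin n → ℤ) →* kˣ) (s : ChartSections E σ) :
    evalPair E σ t t' (pullSec ((mulFace (torus k n) (toricOver k Δ)).left ≫
      (projMap (torus k n) (toricOver k Δ)).left) E.sheaf (chartOpen k Δ σ) (tripleOpen k σ)
        le_rfl s) = s :=
  sectionPull_pullSec _ _ _ _ _ _ _ _ s

/-- If `h^*χ(m)` has the constant value `c` on `{(t, t')} × X_Δ`, for `h : T × T × X_Δ → T × X_Δ`,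
then multiplication with `h^*χ(m)` becomes multiplication with `c` after restriction. -/
lemma evalPair_smul (t t' : Multiplicative (Fin n → ℤ) →* kˣ)
    (h : torus k n ⊗ (torus k n ⊗ toricOver k Δ) ⟶ torus k n ⊗ toricOver k Δ)
    (hV : tripleOpen k σ ≤ h.left ⁻¹ᵁ prodOpen k Δ σ) (m : Fin n → ℤ) (c : k)
    (hc : pull ((pairSection k Δ t t' ≫ h) ≫ fst _ _).left (AddMonoidAlgebra.single m 1) =
      pull (toricOver k Δ).hom c) (x) :
    evalPair E σ t t' (h.left.appLE (prodOpen k Δ σ) (tripleOpen k σ) hV (charFun k Δ σ m) • x) =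
      c • evalPair E σ t t' x := by
  refine (sectionPull_smul _ _ _ _ _ _ _ _ _).trans ?_
  have e := Scheme.Hom.appLE_comp_appLE (pairSection k Δ t t').left h.left (prodOpen k Δ σ)
    (tripleOpen k σ) (chartOpen k Δ σ) hV (le_preimage_pairSection σ t t')
  have e2 := ConcreteCategory.congr_hom e (charFun k Δ σ m)
  have e3 := e2.trans (appLE_charFun_of_const σ (pairSection k Δ t t' ≫ h)
    (fun x hx => hV (le_preimage_pairSection σ t t' hx)) m c hc)
  refine (congrArg (fun r : Γ((toricOver k Δ).left, chartOpen k Δ σ) =>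
    r • (show Γ(E.sheaf, chartOpen k Δ σ) from evalPair E σ t t' x)) e3).trans ?_
  rfl

/-- The components of the coaction of a section are homogeneous. -/
lemma mem_weightSpace_of_coaction_eq [Infinite k] {v : ChartSections E σ}
    (s : (Fin n → ℤ) →₀ ChartSections E σ)
    (hv : coaction E σ v = s.sum fun m w => charFun k Δ σ m • trivialCoaction E σ w)
    (m : Fin n → ℤ) : s m ∈ weightSpace E σ m := by
  classical
  -- `s' m` are the components of the coaction of `s m`; the claim is `s' m m' = 0` for `m' ≠ m`
  choose s' hs' using fun m => exists_eq_sum_trivialCoaction E σ (coaction E σ (s m))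
  have key := E.linearization.cocycle.sum_eq (U := chartOpen k Δ σ) (V := prodOpen k Δ σ)
    (V' := tripleOpen k σ) (prodOpen_le k Δ σ) le_rfl le_rfl (tripleOpen_le_actFace σ)
    (tripleOpen_le_projFace σ) le_rfl s.support (fun m => (s' m).support)
    (fun m => charFun k Δ σ m) (fun _ m => charFun k Δ σ m) v s (fun m => s' m) hv
    (fun m _ => hs' m)
  by_cases hm : m ∈ s.support
  swap
  · rw [Finsupp.notMem_support_iff.1 hm]; exact zero_mem _
  -- independence of characters in the first variable
  have h1 : ∀ t', charEval k m t' • s m -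
      ∑ m' ∈ (s' m).support, charEval k m' t' • s' m m' = 0 := by
    intro t'
    refine eq_zero_of_sum_charEval_smul (k := k) s.support (fun m => charEval k m t' • s m -
      ∑ m' ∈ (s' m).support, charEval k m' t' • s' m m') (fun t => ?_) m hm
    have e := congrArg (evalPair E σ t t') key
    rw [map_sum, map_sum] at e
    simp only [smul_sub, Finset.sum_sub_distrib]
    rw [sub_eq_zero]
    refine Eq.trans (Finset.sum_congr rfl fun m _ => ?_)
      (e.trans (Finset.sum_congr rfl fun m _ => ?_))
    · rw [evalPair_smul E σ t t' (mulFace _ _) le_rfl m (charEval k m t * charEval k m t'),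
        evalPair_pullSec, mul_smul]
      rw [pairSection_mulFace_fst, pull_lift_mul, pull_constPoint, pull_constPoint, map_mul]
    · rw [evalPair_smul E σ t t' (actFace _ _) (tripleOpen_le_actFace σ) m (charEval k m t),
        map_sum]
      · congr 1
        refine Finset.sum_congr rfl fun m' _ => ?_
        rw [evalPair_smul E σ t t' (projFace _ _) (tripleOpen_le_projFace σ) m' (charEval k m' t'),
          evalPair_pullSec]
        rw [pairSection_projFace_fst, pull_constPoint]
      · rw [pairSection_actFace_fst, pull_constPoint]
  -- independence of characters in the second variable
  have h2 := eq_zero_of_sum_charEval_smul (k := k) (insert m (s' m).support)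
    (fun m' => (if m' = m then s m else 0) - s' m m') (fun t => by
      simp only [smul_sub, Finset.sum_sub_distrib, smul_ite, smul_zero]
      rw [Finset.sum_ite_eq' _ m, if_pos (Finset.mem_insert_self _ _), ← h1 t]
      congr 1
      refine (Finset.sum_subset (Finset.subset_insert _ _) fun m' _ hm' => ?_).symm
      rw [Finsupp.notMem_support_iff.1 hm', smul_zero])
  have h3 : s' m = Finsupp.single m (s m) := by
    ext m'
    by_cases hm' : m' ∈ insert m (s' m).support
    · have := sub_eq_zero.1 (h2 m' hm')
      rw [← this, Finsupp.single_apply]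
      simp only [eq_comm]
    · rw [Finset.mem_insert, not_or, Finsupp.notMem_support_iff] at hm'
      rw [hm'.2, Finsupp.single_apply, if_neg (Ne.symm hm'.1)]
  have h4 := hs' m
  rw [h3, Finsupp.sum_single_index (by rw [map_zero, smul_zero])] at h4
  exact h4

/-- The module `Γ(U_σ, E)` is spanned by homogeneous sections. -/
lemma span_weightSpace [Infinite k] :
    Submodule.span (CoordRing k σ.1) (⋃ m, (weightSpace E σ m : Set (ChartSections E σ))) = ⊤ := by
  have : E.sheaf.IsQuasicoherent := E.quasicoherent
  refine Submodule.eq_top_iff'.2 fun v => ?_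
  have hspan := span_range_pullSec (actMap (torus k n) (toricOver k Δ)).left E.sheaf
    (isAffineOpen_chartOpen k Δ σ) (isAffineOpen_prodOpen k Δ σ) (prodOpen_le k Δ σ)
  have hΦ : Function.Bijective (E.linearization.iso.hom.app (prodOpen k Δ σ)) :=
    (ConcreteCategory.isIso_iff_bijective _).1 inferInstance
  -- `v` is the restriction of `p^*v = Φ(y)` to `{1} × U_σ`, and `y` is a combination of
  -- sections `a^*w`
  obtain ⟨y, hy⟩ := hΦ.2 (trivialCoaction E σ v)
  have hmem : y ∈ Submodule.span Γ((torus k n ⊗ toricOver k Δ).left, prodOpen k Δ σ) _ :=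
    hspan.symm ▸ Submodule.mem_top
  rw [← evalPoint_trivialCoaction E σ 1 v, ← hy]
  clear hy
  induction hmem using Submodule.span_induction with
  | zero => rw [map_zero, map_zero]; exact zero_mem _
  | add x y _ _ hx hy => rw [map_add, map_add]; exact add_mem hx hy
  | smul f x _ hx =>
    obtain ⟨b, hb⟩ := exists_evalPoint_smul E σ 1 f
    rw [Scheme.Modules.Hom.app_smul, hb]
    exact Submodule.smul_mem _ b hx
  | mem x hx =>
    obtain ⟨w, rfl⟩ := hx
    change evalPoint E σ 1 (coaction E σ w) ∈ _
    obtain ⟨s, hs⟩ := exists_eq_sum_trivialCoaction E σ (coaction E σ w)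
    rw [hs, Finsupp.sum, map_sum]
    refine Submodule.sum_mem _ fun m _ => ?_
    rw [evalPoint_charFun_smul, evalPoint_trivialCoaction]
    exact Submodule.subset_span (Set.mem_iUnion.2 ⟨m, Submodule.smul_mem _ _
      (mem_weightSpace_of_coaction_eq E σ s hs m)⟩)

end Decomposition

end Toric

/-! ### Chains in `M`, and finite families -/

namespace Toric

section ConeOrder

variable {n : ℕ} {σ : PointedCone ℝ (Fin n → ℝ)}

lemma mem_perp_of_mem_of_neg_mem {m : Fin n → ℤ} (h : m ∈ dualMonoid σ) (h' : -m ∈ dualMonoid σ) :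
    m ∈ perp σ := by
  intro v hv
  have h1 := h v hv
  have h2 := h' v hv
  rw [pairing_neg_left] at h2
  linarith

lemma mem_dualMonoid_of_mem_perp {m : Fin n → ℤ} (h : m ∈ perp σ) : m ∈ dualMonoid σ :=
  fun v hv => (h v hv).ge

lemma LtCone.add_right {m m' : Fin n → ℤ} (h : LtCone σ m m') (d : Fin n → ℤ) :
    LtCone σ (m + d) (m' + d) := by
  simpa only [LtCone, LeCone, add_sub_add_right_eq_sub] using h

/-- A rational polyhedral cone admits a height: an integer-valued function on `M` which is
monotone and strictly monotone for the order given by the cone. -/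
lemma IsRationalPolyhedral.exists_height (hσ : IsRationalPolyhedral σ) :
    ∃ φ : (Fin n → ℤ) → ℤ, (∀ m m', LeCone σ m m' → φ m ≤ φ m') ∧
      ∀ m m', LtCone σ m m' → φ m < φ m' := by
  obtain ⟨S, rfl⟩ := hσ
  have hmem : ∀ v ∈ S, (fun i => (v i : ℝ)) ∈ PointedCone.hull ℝ
      ((fun (v : Fin n → ℤ) (i : Fin n) => (v i : ℝ)) '' (S : Set (Fin n → ℤ))) :=
    fun v hv => Submodule.subset_span ⟨v, hv, rfl⟩
  have hpair : ∀ m v : Fin n → ℤ, pairing m (fun i => (v i : ℝ)) = ((m ⬝ᵥ v : ℤ) : ℝ) := by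
    intro m v
    simp [pairing, dotProduct]
  have hle : ∀ m m', LeCone (PointedCone.hull ℝ
      ((fun (v : Fin n → ℤ) (i : Fin n) => (v i : ℝ)) '' (S : Set (Fin n → ℤ)))) m m' →
      ∀ v ∈ S, m ⬝ᵥ v ≤ m' ⬝ᵥ v := by
    intro m m' h v hv
    have := h _ (hmem v hv)
    rw [hpair, sub_dotProduct] at this
    exact sub_nonneg.1 (by exact_mod_cast this)
  refine ⟨fun m => ∑ v ∈ S, m ⬝ᵥ v, fun m m' h => Finset.sum_le_sum (hle m m' h),
    fun m m' h => Finset.sum_lt_sum (hle m m' h.1) ?_⟩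
  by_contra! hcon
  refine h.2 (mem_dualMonoid_hull fun v hv => ?_)
  rw [hpair, sub_dotProduct]
  exact_mod_cast sub_nonneg.2 (hcon v hv)

/-- A chain in `M` has no lower bound. -/
lemma IsRationalPolyhedral.exists_not_leCone (hσ : IsRationalPolyhedral σ) {c : ℤ → (Fin n → ℤ)}
    (hc : ∀ i, LtCone σ (c (i - 1)) (c i)) (m : Fin n → ℤ) : ∃ i, ¬ LeCone σ m (c i) := by
  obtain ⟨φ, hφ, hφ'⟩ := hσ.exists_height
  have h : ∀ N : ℕ, φ (c (-N)) ≤ φ (c 0) - N := by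
    intro N
    induction N with
    | zero => simp
    | succ N ih =>
      have := hφ' _ _ (hc (-N))
      rw [show (-((N + 1 : ℕ) : ℤ)) = -N - 1 by push_cast; ring]
      push_cast
      omega
  refine ⟨-((φ (c 0) - φ m).toNat + 1 : ℕ), fun hle => ?_⟩
  have h1 := hφ _ _ hle
  have h2 := h ((φ (c 0) - φ m).toNat + 1)
  push_cast at h1 h2
  omega

lemma leCone_of_chain {c : ℤ → (Fin n → ℤ)} (hc : ∀ i, LtCone σ (c (i - 1)) (c i)) {i j : ℤ}
    (hij : i ≤ j) : LeCone σ (c i) (c j) := by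
  induction j, hij using Int.leInduction with
  | base => exact LeCone.refl _ _
  | succ j _ ih =>
    have := (hc (j + 1)).1
    rw [add_sub_cancel_right] at this
    exact ih.trans this

/-- An infinite descending sequence extends to a chain indexed by the integers. -/
lemma exists_chain_of_descending {f : ℕ → (Fin n → ℤ)} (hf : ∀ i, LtCone σ (f (i + 1)) (f i)) :
    ∃ c : ℤ → (Fin n → ℤ), (∀ i, LtCone σ (c (i - 1)) (c i)) ∧ ∀ N : ℕ, c (-N) = f N := by
  refine ⟨fun i => f (-i).toNat + i.toNat • (f 0 - f 1), fun i => ?_, fun N => by simp⟩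
  rcases le_or_gt i 0 with hi | hi
  · have h1 : (-(i - 1)).toNat = (-i).toNat + 1 := by omega
    have h2 : (i - 1).toNat = 0 := by omega
    have h3 : i.toNat = 0 := by omega
    simp only [h1, h2, h3, zero_smul, add_zero]
    exact hf _
  · have h1 : (-(i - 1)).toNat = 0 := by omega
    have h2 : i.toNat = (i - 1).toNat + 1 := by omega
    have h3 : (-i).toNat = 0 := by omega
    simp only [h1, h2, h3]
    have := (hf 0).add_right ((f 0 - f 1) + (i - 1).toNat • (f 0 - f 1))
    convert this using 1
    · rw [zero_add]; abel
    · rw [succ_nsmul']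

end ConeOrder

section FiniteFamily

variable {k : Type u} [Field k] {n : ℕ} {Δ : Fan n}
  (E : EquivariantQCoh (torus k n) (toricOver k Δ)) (σ : Δ.cones)

lemma single_smul_mem_weightSpace {m m' : Fin n → ℤ} {s : ChartSections E σ}
    (hs : s ∈ weightSpace E σ m) (d : dualMonoid σ.1) (h : m + d = m') :
    (AddMonoidAlgebra.single d 1 : CoordRing k σ.1) • s ∈ weightSpace E σ m' := by
  subst h
  exact coaction_single_smul E σ d 1 hs

lemma single_eq_smul_single_one (d : dualMonoid σ.1) (c : k) (s : ChartSections E σ) :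
    (AddMonoidAlgebra.single d c : CoordRing k σ.1) • s =
      c • (AddMonoidAlgebra.single d 1 : CoordRing k σ.1) • s := by
  rw [← smul_assoc]
  congr 1
  simp

/-- A graded submodule which generates `Γ(U_σ, E)` contains all homogeneous sections. -/
lemma weightSpace_le_of_span_eq_top [Infinite k]
    (P : (Fin n → ℤ) → Submodule k (ChartSections E σ)) (hP : ∀ m, P m ≤ weightSpace E σ m)
    (hsmul : ∀ m, ∀ s ∈ P m, ∀ d : dualMonoid σ.1,
      (AddMonoidAlgebra.single d 1 : CoordRing k σ.1) • s ∈ P (m + d))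
    (hspan : Submodule.span (CoordRing k σ.1) (⋃ m, (P m : Set (ChartSections E σ))) = ⊤)
    (m : Fin n → ℤ) : weightSpace E σ m ≤ P m := by
  classical
  intro s hs
  have hsum : s ∈ ⨆ m, P m := by
    have h : s ∈ Submodule.span (CoordRing k σ.1) (⋃ m, (P m : Set (ChartSections E σ))) :=
      hspan.symm ▸ Submodule.mem_top
    clear hs
    induction h using Submodule.span_induction with
    | zero => exact zero_mem _
    | add x y _ _ hx hy => exact add_mem hx hy
    | mem x hx =>
      obtain ⟨m, hm⟩ := Set.mem_iUnion.1 hx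
      exact Submodule.mem_iSup_of_mem m hm
    | smul r x _ hx =>
      induction r using AddMonoidAlgebra.induction_linear with
      | zero => rw [zero_smul]; exact zero_mem _
      | add a b ha hb => rw [add_smul]; exact add_mem ha hb
      | single d c =>
        rw [single_eq_smul_single_one]
        refine Submodule.smul_mem _ c ?_
        clear * - hsmul hx
        induction hx using Submodule.iSup_induction' with
        | zero => rw [smul_zero]; exact zero_mem _
        | add x y _ _ hx hy => rw [smul_add]; exact add_mem hx hy
        | mem m x hx => exact Submodule.mem_iSup_of_mem _ (hsmul m x hx d)
  obtain ⟨f, hf, hfs⟩ := (Submodule.mem_iSup_iff_exists_finsupp _ _).1 hsum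
  have h0 := eq_zero_of_sum_weightSpace E σ (insert m f.support)
    (fun m' => f m' - if m' = m then s else 0) (fun m' _ => by
      refine sub_mem (hP _ (hf m')) ?_
      split_ifs with h
      · rw [h]; exact hs
      · exact zero_mem _) (by
      rw [Finset.sum_sub_distrib, Finset.sum_ite_eq' _ m, if_pos (Finset.mem_insert_self _ _),
        sub_eq_zero, ← hfs]
      refine (Finset.sum_subset (Finset.subset_insert _ _) fun m' _ hm' => ?_).symm
      exact Finsupp.notMem_support_iff.1 hm') m (Finset.mem_insert_self _ _)
  rw [if_pos rfl, sub_eq_zero] at h0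
  rw [← h0]
  exact hf m

/-- If `Γ(U_σ, E)` is finitely generated, then it has finitely many homogeneous generators `g`, and
`E_m` is spanned by the sections `χ(m - deg g) g`. -/
lemma exists_homogeneous_generators [Infinite k]
    [hfin : Module.Finite (CoordRing k σ.1) (ChartSections E σ)] :
    ∃ (T : Finset (ChartSections E σ)) (deg : ChartSections E σ → (Fin n → ℤ)),
      (∀ g ∈ T, g ∈ weightSpace E σ (deg g)) ∧ ∀ m, weightSpace E σ m = Submodule.span k
        {s | ∃ g ∈ T, ∃ d : dualMonoid σ.1, deg g + d = m ∧
          s = (AddMonoidAlgebra.single d 1 : CoordRing k σ.1) • g} := by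
  classical
  have hfg := hfin.fg_top
  rw [← span_weightSpace E σ, Submodule.fg_span_iff_fg_span_finset_subset] at hfg
  obtain ⟨T, hT, hspan⟩ := hfg
  have : ∀ g : ChartSections E σ, ∃ m, g ∈ T → g ∈ weightSpace E σ m := by
    intro g
    by_cases hg : g ∈ T
    · obtain ⟨m, hm⟩ := Set.mem_iUnion.1 (hT hg)
      exact ⟨m, fun _ => hm⟩
    · exact ⟨0, fun h => absurd h hg⟩
  choose deg hdeg using this
  refine ⟨T, deg, hdeg, fun m => ?_⟩
  have hle : ∀ m, Submodule.span k {s | ∃ g ∈ T, ∃ d : dualMonoid σ.1, deg g + d = m ∧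
      s = (AddMonoidAlgebra.single d 1 : CoordRing k σ.1) • g} ≤ weightSpace E σ m := by
    intro m
    rw [Submodule.span_le]
    rintro _ ⟨g, hg, d, hd, rfl⟩
    exact single_smul_mem_weightSpace E σ (hdeg g hg) d hd
  refine le_antisymm (weightSpace_le_of_span_eq_top E σ _ hle ?_ ?_ m) (hle m)
  · intro m s hs d
    induction hs using Submodule.span_induction with
    | zero => rw [smul_zero]; exact zero_mem _
    | add x y _ _ hx hy => rw [smul_add]; exact add_mem hx hy
    | smul c x _ hx => rw [smul_comm]; exact Submodule.smul_mem _ c hx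
    | mem x hx =>
      obtain ⟨g, hg, d', hd', rfl⟩ := hx
      refine Submodule.subset_span ⟨g, hg, d' + d, ?_, ?_⟩
      · rw [AddSubmonoid.coe_add, ← add_assoc, hd']
      · rw [smul_smul, AddMonoidAlgebra.single_mul_single, one_mul, add_comm]
  · refine top_le_iff.1 ?_
    rw [← span_weightSpace E σ, hspan]
    refine Submodule.span_mono fun g hg => Set.mem_iUnion.2 ⟨deg g, ?_⟩
    refine Submodule.subset_span ⟨g, hg, 0, by simp, ?_⟩
    rw [← AddMonoidAlgebra.one_def, one_smul]

/-- The family of a finitely generated module is finite. -/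
lemma isFinite_associatedFamily [Infinite k]
    [hfin : Module.Finite (CoordRing k σ.1) (ChartSections E σ)] :
    (associatedFamily E σ).IsFinite := by
  classical
  obtain ⟨T, deg, hdeg, hW⟩ := exists_homogeneous_generators E σ
  refine ⟨fun m => ?_, fun c hc => ?_, ?_⟩
  · change Module.Finite k (weightSpace E σ m)
    rw [hW]
    refine Module.Finite.span_of_finite k (Set.Finite.subset (T.finite_toSet.image fun g =>
      if h : m - deg g ∈ dualMonoid σ.1 then
        (AddMonoidAlgebra.single ⟨m - deg g, h⟩ 1 : CoordRing k σ.1) • g else 0) ?_)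
    rintro _ ⟨g, hg, d, hd, rfl⟩
    have e : m - deg g = d := by rw [← hd, add_sub_cancel_left]
    refine ⟨g, hg, ?_⟩
    simp only [e]
    rw [dif_pos d.2]
  · -- below `i₀`, no term of the chain is above the degree of a generator
    choose i hi using fun g => (Δ.rational _ σ.2).exists_not_leCone hc (deg g)
    obtain ⟨i₀, hi₀⟩ := (T.image i).bddBelow
    refine ⟨i₀, fun j hj => ?_⟩
    change Subsingleton (weightSpace E σ (c j))
    rw [hW, Submodule.subsingleton_iff_eq_bot, Submodule.span_eq_bot]
    rintro _ ⟨g, hg, d, hd, rfl⟩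
    refine absurd (LeCone.trans (m' := c j) ?_ (leCone_of_chain hc (hj.le.trans
      (hi₀ (Finset.mem_image_of_mem i hg))))) (hi g)
    rw [LeCone, ← hd, add_sub_cancel_left]
    exact d.2
  · refine Set.Finite.subset (T.finite_toSet.image fun g =>
      ((deg g : Fin n → ℤ) : (Fin n → ℤ) ⧸ perp σ.1)) ?_
    rintro _ ⟨m, hm, rfl⟩
    by_contra hcon
    refine hm (Submodule.eq_top_iff'.2 fun s => ?_)
    change s ∈ (⨆ (m') (h : LtCone σ.1 m' m), LinearMap.range (weightMap E σ h.1) :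
      Submodule k (weightSpace E σ m))
    have hs : s.1 ∈ (⨆ (m') (h : LtCone σ.1 m' m), LinearMap.range (weightMap E σ h.1) :
        Submodule k (weightSpace E σ m)).map (weightSpace E σ m).subtype := by
      refine Submodule.span_le.2 ?_ ((hW m).le s.2)
      rintro _ ⟨g, hg, d, hd, rfl⟩
      have hlt : LtCone σ.1 (deg g) m := by
        refine ⟨?_, fun h => hcon ⟨g, hg, ?_⟩⟩
        · rw [LeCone, ← hd, add_sub_cancel_left]; exact d.2
        · refine QuotientAddGroup.eq.2 (mem_perp_of_mem_of_neg_mem ?_ ?_)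
          · rw [← hd, neg_add_cancel_left]; exact d.2
          · rw [LeCone] at h
            rw [neg_add, neg_neg, ← sub_eq_add_neg]
            exact h
      refine ⟨weightMap E σ hlt.1 ⟨g, hdeg g hg⟩,
        Submodule.mem_iSup_of_mem _ (Submodule.mem_iSup_of_mem hlt ⟨_, rfl⟩), ?_⟩
      change (AddMonoidAlgebra.single ⟨m - deg g, _⟩ 1 : CoordRing k σ.1) • g = _
      refine congrArg (fun d : dualMonoid σ.1 =>
        (AddMonoidAlgebra.single d 1 : CoordRing k σ.1) • g) ?_
      refine Subtype.ext (show m - deg g = d from ?_)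
      rw [← hd, add_sub_cancel_left]
    obtain ⟨s', hs', e⟩ := hs
    rwa [← Subtype.ext e]

/-- A module with finite family is generated by the isotypical components `E_m`, for `m` in a finite
set of representatives of the classes in which `E_m` is not generated by the smaller components. -/
lemma finite_of_isFinite_associatedFamily [Infinite k] (h : (associatedFamily E σ).IsFinite) :
    Module.Finite (CoordRing k σ.1) (ChartSections E σ) := by
  classical
  have hfd : ∀ m, Module.Finite k (weightSpace E σ m) := h.finite_dimensional
  -- representatives of the classes in which the component is not generated by smaller ones
  let B : Finset (Fin n → ℤ) := h.generated.toFinset.image Quotient.out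
  have hfg : ∀ m, (Submodule.span (CoordRing k σ.1)
      (weightSpace E σ m : Set (ChartSections E σ))).FG := by
    intro m
    obtain ⟨F, hF⟩ := (Module.Finite.iff_fg.1 (hfd m))
    refine ⟨F, le_antisymm (Submodule.span_mono ?_) (Submodule.span_le.2 ?_)⟩
    · rw [← hF]; exact Submodule.subset_span
    · rw [← hF]; exact Submodule.span_subset_span k (CoordRing k σ.1) _
  let N : Submodule (CoordRing k σ.1) (ChartSections E σ) := ⨆ b ∈ B,
    Submodule.span (CoordRing k σ.1) (weightSpace E σ b : Set (ChartSections E σ))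
  have hN : N.FG := Submodule.fg_biSup B _ fun b _ => hfg b
  suffices hle : ∀ m, (weightSpace E σ m : Set (ChartSections E σ)) ⊆ N by
    refine ⟨?_⟩
    rwa [← span_weightSpace E σ, le_antisymm (Submodule.span_le.2 (Set.iUnion_subset hle))
      (iSup₂_le fun b _ => Submodule.span_mono (Set.subset_iUnion
        (fun m => (weightSpace E σ m : Set (ChartSections E σ))) b))]
  by_contra! hcon
  -- every component outside `N` has a smaller one outside `N`
  have hstep : ∀ m : {m // ¬ (weightSpace E σ m : Set (ChartSections E σ)) ⊆ N},
      ∃ m' : {m // ¬ (weightSpace E σ m : Set (ChartSections E σ)) ⊆ N}, LtCone σ.1 m'.1 m.1 := by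
    rintro ⟨m, hm⟩
    by_contra! hall
    apply hm
    by_cases hbad : (⨆ (m') (h : LtCone σ.1 m' m), LinearMap.range (weightMap E σ h.1) :
      Submodule k (weightSpace E σ m)) = ⊤
    · intro s hs
      have hle : (⨆ (m') (h : LtCone σ.1 m' m), LinearMap.range (weightMap E σ h.1) :
          Submodule k (weightSpace E σ m)) ≤
          (N.restrictScalars k).comap (weightSpace E σ m).subtype := by
        refine iSup₂_le fun m' hm' => ?_
        rintro _ ⟨t, rfl⟩
        refine N.smul_mem (AddMonoidAlgebra.single ⟨m - m', hm'.1⟩ 1 : CoordRing k σ.1) ?_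
        by_contra ht
        exact hall ⟨m', fun hsub => ht (hsub t.2)⟩ hm'
      exact hle (hbad ▸ Submodule.mem_top : (⟨s, hs⟩ : weightSpace E σ m) ∈ _)
    · -- multiplication with `χ(m - b)` is an isomorphism from `E_b` to `E_m`
      have hmB : (m : (Fin n → ℤ) ⧸ perp σ.1) ∈ h.generated.toFinset := by
        rw [Set.Finite.mem_toFinset]
        exact ⟨m, hbad, rfl⟩
      set b : Fin n → ℤ := Quotient.out (m : (Fin n → ℤ) ⧸ perp σ.1) with hb
      have hbB : b ∈ B := Finset.mem_image_of_mem _ hmB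
      have hperp : -b + m ∈ perp σ.1 := QuotientAddGroup.eq.1 (Quotient.out_eq _)
      have hpos := mem_dualMonoid_of_mem_perp hperp
      have hneg := mem_dualMonoid_of_mem_perp (neg_mem hperp)
      intro s hs
      have h1 : (AddMonoidAlgebra.single ⟨_, hneg⟩ 1 : CoordRing k σ.1) • s ∈ N := by
        refine (le_iSup₂ (f := fun b (_ : b ∈ B) => Submodule.span (CoordRing k σ.1)
          (weightSpace E σ b : Set (ChartSections E σ))) b hbB) (Submodule.subset_span ?_)
        refine single_smul_mem_weightSpace E σ hs _ ?_
        change m + -(-b + m) = b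
        abel
      have h2 := N.smul_mem (AddMonoidAlgebra.single ⟨_, hpos⟩ 1 : CoordRing k σ.1) h1
      rw [smul_smul, AddMonoidAlgebra.single_mul_single, one_mul] at h2
      have e : (⟨_, hpos⟩ + ⟨_, hneg⟩ : dualMonoid σ.1) = 0 := Subtype.ext (add_neg_cancel _)
      rwa [e, ← AddMonoidAlgebra.one_def, one_smul] at h2
  obtain ⟨m₀, hm₀⟩ := hcon
  choose next hnext using hstep
  let f : ℕ → {m // ¬ (weightSpace E σ m : Set (ChartSections E σ)) ⊆ N} :=
    fun i => next^[i] ⟨m₀, hm₀⟩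
  obtain ⟨c, hc, hcf⟩ := exists_chain_of_descending (σ := σ.1) (f := fun i => (f i).1) (fun i => by
    simp only [f, Function.iterate_succ_apply']
    exact hnext _)
  obtain ⟨i₀, hi₀⟩ := h.chain c hc
  have hsub := hi₀ (-((-i₀).toNat + 1 : ℕ)) (by omega)
  rw [hcf] at hsub
  change Subsingleton (weightSpace E σ (f ((-i₀).toNat + 1)).1) at hsub
  refine (f ((-i₀).toNat + 1)).2 fun s hs => ?_
  have h0 : (⟨s, hs⟩ : weightSpace E σ (f ((-i₀).toNat + 1)).1) = 0 := Subsingleton.elim _ _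
  have h1 : s = 0 := congrArg Subtype.val h0
  rw [h1]
  exact N.zero_mem

end FiniteFamily

end Toric

/-! ### Coherence on the charts -/

namespace Toric

section Coherent

variable {k : Type u} [Field k] {n : ℕ} {Δ : Fan n}
  (E : EquivariantQCoh (torus k n) (toricOver k Δ))

lemma finite_coordRing_iff (σ : Δ.cones) :
    Module.Finite (CoordRing k σ.1) (ChartSections E σ) ↔
      Module.Finite Γ((toricOver k Δ).left, chartOpen k Δ σ) Γ(E.sheaf, chartOpen k Δ σ) := by
  constructor
  · intro h
    exact finite_of_semilinear_surjective (A := CoordRing k σ.1) (M := ChartSections E σ)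
      (coord k Δ σ) (AddMonoidHom.id (ChartSections E σ))
      (by
        rw [Submodule.eq_top_iff']
        exact fun x => Submodule.subset_span ⟨x, rfl⟩) fun _ _ => rfl
  · intro h
    exact finite_of_semilinear_bijective (B := Γ((toricOver k Δ).left, chartOpen k Δ σ))
      (N := Γ(E.sheaf, chartOpen k Δ σ)) (coord k Δ σ) (coord_bijective σ).2
      (AddMonoidHom.id (ChartSections E σ)) Function.bijective_id fun _ _ => rfl

/-- Coherence of `E` may be tested on the open cover by the `U_σ`. -/
lemma isCoherent_iff_finite_chartSections : IsCoherent E.sheaf ↔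
    ∀ σ : Δ.cones, Module.Finite (CoordRing k σ.1) (ChartSections E σ) := by
  have : E.sheaf.IsQuasicoherent := E.quasicoherent
  refine ⟨fun h σ => (finite_coordRing_iff E σ).2
    (finite_sections_of_isCoherent E.sheaf h (isAffineOpen_chartOpen k Δ σ)), fun h =>
    ⟨E.quasicoherent, fun x => ?_⟩⟩
  obtain ⟨σ, y, hy⟩ := (toricCover k Δ).exists_eq x
  exact ⟨chartOpen k Δ σ, ⟨y, hy⟩, isAffineOpen_chartOpen k Δ σ, (finite_coordRing_iff E σ).1 (h σ)⟩

end Coherent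

end Toric

end

theorem mainTheorem5 {k : Type u} [Field k] [IsAlgClosed k] {n : ℕ} (Δ : Toric.Fan n)
    (E : Toric.EquivariantQCoh (Toric.torus k n) (Toric.toricOver k Δ)) :
    Toric.IsCoherent E.sheaf ↔ ∀ σ : Δ.cones, (Toric.associatedFamily E σ).IsFinite := by
  rw [Toric.isCoherent_iff_finite_chartSections]
  exact forall_congr' fun σ => ⟨fun _ => Toric.isFinite_associatedFamily E σ,
    Toric.finite_of_isFinite_associatedFamily E σ⟩
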